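/- Let $d\in\mathbb N$, $\hbar>0$, $h=2\pi\hbar$, $\mathfrak h=L^2(\mathbb R^d;\mathbb C)$, and write $x$ for the position operator and $\boldsymbol p=-i\hbar\nabla$ for the momentum operator on $\mathfrak h$. A density operator on $\mathfrak h$ is a bounded operator $\boldsymbol\rho\ge 0$ with $h^d\,\mathrm{Tr}\,\boldsymbol\rho=1$; a density operator on $\mathfrak h\otimes\mathfrak h\simeq L^2(\mathbb R^{d}\times\mathbb R^d)$ is a bounded operator $\boldsymbol\gamma\ge 0$ with $h^{2d}\,\mathrm{Tr}\,\boldsymbol\gamma=1$. Traces $\mathrm{Tr}(A^{1/2}CA^{1/2})\in[0,\infty]$ with $C\ge0$ unbounded self-adjoint are understood in the sense of quadratic forms. For a Borel probability measure $f$ on $\mathbb R^{2d}$ (in particular, for a probability density) and a density operator $\boldsymbol\rho$ on $\mathfrak h$, let $\mathcal C(f,\boldsymbol\rho)$ be the set of operator-valued measures $\boldsymbol\gamma$ on $\mathbb R^{2d}$ with values in the nonnegative bounded operators on $\mathfrak h$ such that $\boldsymbol\gamma(\mathbb R^{2d})=\boldsymbol\rho$ and $h^d\,\mathrm{Tr}\,\boldsymbol\gamma(A)=f(A)$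 for every Borel set $A$. Such a measure has a density, $\boldsymbol\gamma(\mathrm dz)=\Gamma(z)\,f(\mathrm dz)$ with $\Gamma(z)\ge 0$. Put $$W_\hbar(f,\boldsymbol\rho)^2=\inf_{\boldsymbol\gamma\in\mathcal C(f,\boldsymbol\rho)} h^d\int_{\mathbb R^{2d}}\mathrm{Tr}\big(\Gamma(z)^{1/2}\,\boldsymbol c(z)\,\Gamma(z)^{1/2}\big)\,f(\mathrm dz),\qquad \boldsymbol c(z)=|y-x|^2+|\xi-\boldsymbol p|^2,\quad z=(y,\xi).$$ For density operators $\boldsymbol\rho_1,\boldsymbol\rho_2$ on $\mathfrak h$, let $\mathcal C(\boldsymbol\rho_1,\boldsymbol\rho_2)$ be the set of density operators $\boldsymbol\gamma$ on $\mathfrak h\otimes\mathfrak h$ whose partial traces over the first and second variable satisfy $h^d\,\mathrm{tr}_1(\boldsymbol\gamma)=\boldsymbol\rho_2$ and $h^d\,\mathrm{tr}_2(\boldsymbol\gamma)=\boldsymbol\rho_1$, and put $$\mathrm{MK}_\hbar(\boldsymbol\rho_1,\boldsymbol\rho_2)^2=\inf_{\boldsymbol\gamma\in\mathcal C(\boldsymbol\rho_1,\boldsymbol\rho_2)}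 h^{2d}\,\mathrm{Tr}\big(\boldsymbol\gamma^{1/2}\,\boldsymbol c\,\boldsymbol\gamma^{1/2}\big),\qquad \boldsymbol c=|x_1-x_2|^2+|\boldsymbol p_1-\boldsymbol p_2|^2 .$$ Both $W_\hbar$ and $\mathrm{MK}_\hbar$ take values in $[0,\infty]$. Finally, the Toeplitz operator of $f$ is $$\widetilde{\boldsymbol\rho}_f=h^{-d}\int_{\mathbb R^{2d}}|\psi_z\rangle\langle\psi_z|\,f(\mathrm dz),\qquad \psi_z(y)=(\pi\hbar)^{-d/4}e^{-|y-x|^2/(2\hbar)}\,e^{i\xi\cdot(y-x/2)/\hbar},\quad z=(x,\xi).$$ **Proposition.** Let $\boldsymbol\rho$ be a density operator on $\mathfrak h$ with two moments, that is $h^d\,\mathrm{Tr}\big(\sqrt{\boldsymbol\rho}\,(|x|^2+|\boldsymbol p|^2)\sqrt{\boldsymbol\rho}\big)<\infty$, and let $f$ be a Borel probability measure on $\mathbb R^{2d}$ with $\int_{\mathbb R^{2d}}|z|^2\,f(\mathrm dz)<\infty$. Then $$\mathrm{MK}_\hbar(\widetilde{\boldsymbol\rho}_f,\boldsymbol\rho)^2\le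 W_\hbar(f,\boldsymbol\rho)^2+d\,\hbar .$$ -/

import Mathlib

namespace QOT

open MeasureTheory
open scoped ENNReal InnerProductSpace

/-- Configuration space `ℝ^d` with its Euclidean norm. -/
abbrev Pos (d : ℕ) : Type := EuclideanSpace ℝ (Fin d)

/-- Phase space `ℝ^d × ℝ^d`, with points `z = (y, ξ)`. (The norm of this product type is never
used: `|z|²` is always written `|y|² + |ξ|²`.) -/
abbrev Phase (d : ℕ) : Type := Pos d × Pos d

/-- The one-particle Hilbert space `𝔥 = L²(ℝ^d; ℂ)`. -/
abbrev H1 (d : ℕ) : Type := Lp ℂ 2 (volume : Measure (Pos d))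

/-- The two-particle Hilbert space `𝔥 ⊗ 𝔥`, realised as `L²(ℝ^d × ℝ^d; ℂ)`. -/
abbrev H2 (d : ℕ) : Type := Lp ℂ 2 (volume : Measure (Pos d × Pos d))

/-- Planck's constant `h = 2πħ`. -/
noncomputable def planck (ħ : ℝ) : ℝ := 2 * Real.pi * ħ

/-! ### Traces of positive operators and of positive quadratic forms -/

section Trace

variable {H : Type*} [NormedAddCommGroup H] [InnerProductSpace ℂ H] [CompleteSpace H]

/-- The trace in `[0, ∞]` of a nonnegative quadratic form `q`: the supremum of `∑ᵢ q(eᵢ)` over all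
finite orthonormal families. -/
noncomputable def formTrace (q : H → ℝ≥0∞) : ℝ≥0∞ :=
  ⨆ (n : ℕ) (e : Fin n → H) (_ : Orthonormal ℂ e), ∑ i, q (e i)

/-- `⟨φ, A φ⟩` in `[0, ∞)`, for a positive operator `A`. -/
noncomputable def quadForm (A : H →L[ℂ] H) (φ : H) : ℝ≥0∞ :=
  ENNReal.ofReal (⟪φ, A φ⟫_ℂ).re

/-- `Tr A`, in `[0, ∞]`, for a positive bounded operator `A`. -/
noncomputable def opTrace (A : H →L[ℂ] H) : ℝ≥0∞ := formTrace (quadForm A)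

/-- `Tr (A^{1/2} C A^{1/2})`, in `[0, ∞]`, for a positive bounded operator `A` and an unbounded
positive self-adjoint operator `C` given by its quadratic form `q`
(`q ψ = ‖C^{1/2} ψ‖²` on the form domain, `q ψ = ∞` outside it). -/
noncomputable def sandwichTrace (q : H → ℝ≥0∞) (A : H →L[ℂ] H) : ℝ≥0∞ :=
  formTrace fun e => q (CFC.sqrt A e)

/-- Density operators, in the semiclassical normalisation: `A ≥ 0` and `h^n Tr A = 1`. -/
def IsDensityOperator (ħ : ℝ) (n : ℕ) (A : H →L[ℂ] H) : Prop :=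
  0 ≤ A ∧ ENNReal.ofReal (planck ħ ^ n) * opTrace A = 1

end Trace

/-! ### Position and momentum -/

section Momentum

variable {V : Type*} [NormedAddCommGroup V] [NormedSpace ℝ V] [MeasureSpace V]

/-- `g = -iħ ∂_v ψ` in the sense of distributions, with `ψ, g ∈ L²`. -/
def IsMomentum (ħ : ℝ) (v : V) (ψ g : Lp ℂ 2 (volume : Measure V)) : Prop :=
  ∀ φ : V → ℂ, ContDiff ℝ (⊤ : ℕ∞) φ → HasCompactSupport φ →
    ∫ x, g x * φ x = Complex.I * (ħ : ℂ) * ∫ x, ψ x * fderiv ℝ φ x v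

/-- `‖(p_v - a) ψ‖²` with `p_v = -iħ ∂_v`; it is `∞` if `p_v ψ ∉ L²`. (There is at most one `g`
over which the infimum is taken.) -/
noncomputable def momentumForm (ħ : ℝ) (v : V) (a : ℝ) (ψ : Lp ℂ 2 (volume : Measure V)) :
    ℝ≥0∞ :=
  ⨅ (g : Lp ℂ 2 (volume : Measure V)) (_ : IsMomentum ħ v ψ g), ‖g - (a : ℂ) • ψ‖ₑ ^ 2

end Momentum

variable {d : ℕ}

/-- The quadratic form of `c(z) = |y - x|² + |ξ - p|²` on `L²(ℝ^d)`, where `z = (y, ξ)` and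
`p = -iħ∇`. -/
noncomputable def costForm (ħ : ℝ) (z : Phase d) (ψ : H1 d) : ℝ≥0∞ :=
  (∫⁻ x, ‖z.1 - x‖ₑ ^ 2 * ‖ψ x‖ₑ ^ 2) +
    ∑ j, momentumForm ħ (EuclideanSpace.single j (1 : ℝ)) (z.2 j) ψ

/-- The quadratic form of `c = |x₁ - x₂|² + |p₁ - p₂|²` on `L²(ℝ^d × ℝ^d)`, where
`p₁ - p₂ = -iħ(∇₁ - ∇₂)`. -/
noncomputable def costForm₂ (ħ : ℝ) (Ψ : H2 d) : ℝ≥0∞ :=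
  (∫⁻ x : Pos d × Pos d, ‖x.1 - x.2‖ₑ ^ 2 * ‖Ψ x‖ₑ ^ 2) +
    ∑ j, momentumForm ħ
      ((EuclideanSpace.single j (1 : ℝ), -EuclideanSpace.single j (1 : ℝ)) : Pos d × Pos d) 0 Ψ

/-- The class `𝒫₂(𝔥)`: density operators `ρ` with `h^d Tr(√ρ (|x|² + |p|²) √ρ) < ∞`. -/
def HasTwoMoments (ħ : ℝ) (ρ : H1 d →L[ℂ] H1 d) : Prop :=
  IsDensityOperator ħ d ρ ∧
    ENNReal.ofReal (planck ħ ^ d) * sandwichTrace (costForm ħ (0 : Phase d)) ρ < ∞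

/-! ### Semiclassical couplings -/

/-- Couplings of a probability measure `f` on phase space and a density operator `ρ`:
operator-valued measures `γ` with positive values, `γ(ℝ^{2d}) = ρ` and `h^d Tr γ(A) = f(A)`. -/
def IsCoupling (ħ : ℝ) (f : Measure (Phase d)) (ρ : H1 d →L[ℂ] H1 d)
    (γ : VectorMeasure (Phase d) (H1 d →L[ℂ] H1 d)) : Prop :=
  (∀ A, MeasurableSet A → 0 ≤ γ A) ∧ γ Set.univ = ρ ∧
    ∀ A, MeasurableSet A → ENNReal.ofReal (planck ħ ^ d) * opTrace (γ A) = f A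

/-- `γ(dz) = Γ(z) f(dz)`, in the weak sense, with a weakly measurable density `Γ ≥ 0`. For a
coupling of `f` and some `ρ` there is such a `Γ`, unique `f`-almost everywhere. If `f` has a
Lebesgue density, also denoted `f`, then `γ(dz) = γ(z) dz` with `γ(z) = f(z) Γ(z)`. -/
structure IsDensity (f : Measure (Phase d)) (γ : VectorMeasure (Phase d) (H1 d →L[ℂ] H1 d))
    (Γ : Phase d → H1 d →L[ℂ] H1 d) : Prop where
  nonneg : ∀ z, 0 ≤ Γ z
  measurable : ∀ φ ψ : H1 d, Measurable fun z => ⟪φ, Γ z ψ⟫_ℂ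
  integrable : ∀ φ ψ : H1 d, Integrable (fun z => ⟪φ, Γ z ψ⟫_ℂ) f
  integral_eq : ∀ A, MeasurableSet A → ∀ φ ψ : H1 d,
    ∫ z in A, ⟪φ, Γ z ψ⟫_ℂ ∂f = ⟪φ, γ A ψ⟫_ℂ

/-- The cost `h^d ∫ Tr(γ(dz)^{1/2} c(z) γ(dz)^{1/2})` of a semiclassical coupling `γ` of `f`,
computed with the density of `γ` with respect to `f`. All densities agree `f`-almost everywhere,
so that the infimum over them is just their common value. -/
noncomputable def couplingCost (ħ : ℝ) (f : Measure (Phase d))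
    (γ : VectorMeasure (Phase d) (H1 d →L[ℂ] H1 d)) : ℝ≥0∞ :=
  ⨅ (Γ : Phase d → H1 d →L[ℂ] H1 d) (_ : IsDensity f γ Γ),
    ENNReal.ofReal (planck ħ ^ d) * ∫⁻ z, sandwichTrace (costForm ħ z) (Γ z) ∂f

/-- The semiclassical pseudometric `W_ħ(f, ρ)`, with values in `[0, ∞]`. -/
noncomputable def Wh (ħ : ℝ) (f : Measure (Phase d)) (ρ : H1 d →L[ℂ] H1 d) : ℝ≥0∞ :=
  (⨅ (γ : VectorMeasure (Phase d) (H1 d →L[ℂ] H1 d)) (_ : IsCoupling ħ f ρ γ),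
    couplingCost ħ f γ) ^ (1 / 2 : ℝ)

/-! ### Quantum couplings -/

theorem memLp_tensor (χ φ : H1 d) :
    MemLp (fun x : Pos d × Pos d => χ x.1 * φ x.2) 2 (volume : Measure (Pos d × Pos d)) := by
  have hχ := Lp.memLp χ
  have hφ := Lp.memLp φ
  have hm : AEStronglyMeasurable (fun x : Pos d × Pos d => χ x.1 * φ x.2)
      (volume : Measure (Pos d × Pos d)) := by
    rw [Measure.volume_eq_prod]
    exact hχ.1.comp_fst.mul hφ.1.comp_snd
  rw [memLp_two_iff_integrable_sq_norm hm, Measure.volume_eq_prod]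
  have h1 := (memLp_two_iff_integrable_sq_norm hχ.1).1 hχ
  have h2 := (memLp_two_iff_integrable_sq_norm hφ.1).1 hφ
  simpa [mul_pow] using h1.mul_prod h2

/-- The tensor product `χ ⊗ φ`, that is the function `(x₁, x₂) ↦ χ(x₁) φ(x₂)`. -/
noncomputable def tensor (χ φ : H1 d) : H2 d := (memLp_tensor χ φ).toLp _

/-- `⟨φ, tr₁(γ) φ⟩`, where `tr₁` is the partial trace over the first variable of a positive
operator `γ` on `𝔥 ⊗ 𝔥`. -/
noncomputable def partialTrace₁ (γ : H2 d →L[ℂ] H2 d) (φ : H1 d) : ℝ≥0∞ :=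
  formTrace fun χ : H1 d => quadForm γ (tensor χ φ)

/-- `⟨φ, tr₂(γ) φ⟩`, where `tr₂` is the partial trace over the second variable of a positive
operator `γ` on `𝔥 ⊗ 𝔥`. -/
noncomputable def partialTrace₂ (γ : H2 d →L[ℂ] H2 d) (φ : H1 d) : ℝ≥0∞ :=
  formTrace fun χ : H1 d => quadForm γ (tensor φ χ)

/-- Couplings of two density operators: density operators `γ` on `𝔥 ⊗ 𝔥` with
`h^d tr₂(γ) = ρ₁` and `h^d tr₁(γ) = ρ₂`. (Positive operators are determined by their quadratic
forms.) -/
def IsQuantumCoupling (ħ : ℝ) (ρ₁ ρ₂ : H1 d →L[ℂ] H1 d) (γ : H2 d →L[ℂ] H2 d) : Prop :=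
  IsDensityOperator ħ (2 * d) γ ∧
    (∀ φ, ENNReal.ofReal (planck ħ ^ d) * partialTrace₁ γ φ = quadForm ρ₂ φ) ∧
    (∀ φ, ENNReal.ofReal (planck ħ ^ d) * partialTrace₂ γ φ = quadForm ρ₁ φ)

/-- The quantum pseudometric `MK_ħ(ρ₁, ρ₂)`, with values in `[0, ∞]`. -/
noncomputable def MKh (ħ : ℝ) (ρ₁ ρ₂ : H1 d →L[ℂ] H1 d) : ℝ≥0∞ :=
  (⨅ (γ : H2 d →L[ℂ] H2 d) (_ : IsQuantumCoupling ħ ρ₁ ρ₂ γ),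
    ENNReal.ofReal (planck ħ ^ (2 * d)) * sandwichTrace (costForm₂ ħ) γ) ^ (1 / 2 : ℝ)

/-! ### Coherent states and Toeplitz operators -/

/-- `ψ_z(y) = (πħ)^{-d/4} e^{-|y-x|²/(2ħ)} e^{iξ·(y-x/2)/ħ}`, where `z = (x, ξ)`. -/
noncomputable def coherentFun (ħ : ℝ) (z : Phase d) (y : Pos d) : ℂ :=
  (((Real.pi * ħ) ^ (-(d : ℝ) / 4) * Real.exp (-‖y - z.1‖ ^ 2 / (2 * ħ)) : ℝ) : ℂ) *
    Complex.exp (Complex.I * ((⟪z.2, y - (2⁻¹ : ℝ) • z.1⟫_ℝ / ħ : ℝ) : ℂ))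

theorem memLp_coherentFun {ħ : ℝ} (hħ : 0 < ħ) (z : Phase d) :
    MemLp (coherentFun ħ z) 2 (volume : Measure (Pos d)) := by
  have hc : Continuous (coherentFun ħ z) := by
    unfold coherentFun
    fun_prop
  rw [memLp_two_iff_integrable_sq_norm hc.aestronglyMeasurable]
  have hb : (0 : ℝ) < ((1 / ħ : ℝ) : ℂ).re := by
    rw [Complex.ofReal_re]
    positivity
  have h := (GaussianFourier.integrable_cexp_neg_mul_sq_norm_add hb 0 (0 : Pos d)).norm.comp_sub_right z.1
  refine (h.const_mul (((Real.pi * ħ) ^ (-(d : ℝ) / 4)) ^ 2)).congr (ae_of_all _ fun y => ?_)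
  have e1 : ‖Complex.exp (Complex.I * ((⟪z.2, y - (2⁻¹ : ℝ) • z.1⟫_ℝ / ħ : ℝ) : ℂ))‖ = 1 := by
    rw [mul_comm, Complex.norm_exp_ofReal_mul_I]
  have e2 : Complex.exp (-((1 / ħ : ℝ) : ℂ) * (‖y - z.1‖ : ℂ) ^ 2 +
      0 * ((⟪(0 : Pos d), y - z.1⟫_ℝ : ℝ) : ℂ)) =
      ((Real.exp (-(1 / ħ) * ‖y - z.1‖ ^ 2) : ℝ) : ℂ) := by
    push_cast
    congr 1
    ring
  simp only [coherentFun]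
  rw [norm_mul, e1, mul_one, e2, Complex.norm_real, Complex.norm_real, Real.norm_eq_abs,
    Real.norm_eq_abs, Real.abs_exp, sq_abs, mul_pow, ← Real.exp_nat_mul]
  congr 2
  push_cast
  field_simp

/-- The coherent state `ψ_z` as an element of `L²(ℝ^d)`. -/
noncomputable def coherent {ħ : ℝ} (hħ : 0 < ħ) (z : Phase d) : H1 d :=
  (memLp_coherentFun hħ z).toLp _

/-- The Toeplitz operator `h^{-d} ∫ |ψ_z⟩⟨ψ_z| f(dz)` of a finite measure `f`. -/
noncomputable def toeplitz {ħ : ℝ} (hħ : 0 < ħ) (f : Measure (Phase d)) : H1 d →L[ℂ] H1 d :=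
  ((planck ħ ^ d)⁻¹ : ℂ) •
    ∫ z, InnerProductSpace.rankOne ℂ (coherent hħ z) (coherent hħ z) ∂f

end QOT

/-!
For a semiclassical coupling `γ(dz) = Γ(z) f(dz)` of `f` and `ρ`, the operator
`T = h^{-d} ∫ |ψ_z⟩⟨ψ_z| ⊗ Γ(z) f(dz)` on `L²(ℝ^d × ℝ^d)` is a quantum coupling of the Toeplitz
operator of `f` and `ρ` (`exists_isQuantumCoupling`): its marginals are computed from `‖ψ_z‖ = 1`
and from `h^d Tr Γ(z) = 1` for `f`-almost every `z`. It therefore suffices to bound its cost.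

With `Γ(z) = ∑ₗ |χₗ⟩⟨χₗ|`, `χₗ = Γ(z)^{1/2} bₗ`, for a Hilbert basis `b`, the operator `T` is a
superposition of the rank-one operators of `ψ_z ⊗ χₗ`. On such a vector the form of
`|x₁ - x₂|² + |p₁ - p₂|²` equals that of `c(z)` on `χₗ` plus `dħ ‖χₗ‖²`: the coherent state has
mean `z` and variance `ħ / 2` in each of its `2d` phase space coordinates, so cross terms vanish
(`lintegral_position_coherent_tensor`, `exists_isMomentum_coherent_tensor`). Integrating the excess
gives `h^{2d} · h^{-d} · dħ ∫ Tr Γ df = dħ`.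

The trace of the unbounded cost against `T` is compared with this superposition by duality
(`exists_dual_sum_le`): testing against a finite orthonormal family of smooth functions moves the
differential operators onto bounded objects, and Bessel's inequality is applied once on each side.
Positions are handled by the same lemma, after truncation of the multiplier. Neither the square root
of `T` has to be computed, nor does the density of the cost in `z` have to be measurable, since
lower integrals are superadditive.
-/

namespace QOT

open MeasureTheory
open scoped ENNReal InnerProductSpace

/-! ### Traces and square roots of positive operators -/

section Trace

variable {H : Type*} [NormedAddCommGroup H] [InnerProductSpace ℂ H]

theorem enorm_inner_comm (x y : H) : ‖⟪x, y⟫_ℂ‖ₑ = ‖⟪y, x⟫_ℂ‖ₑ := by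
  rw [← ofReal_norm, ← ofReal_norm, norm_inner_symm]

theorem enorm_inner_le_enorm (x y : H) : ‖⟪x, y⟫_ℂ‖ₑ ≤ ‖x‖ₑ * ‖y‖ₑ := by
  rw [← ofReal_norm, ← ofReal_norm, ← ofReal_norm, ← ENNReal.ofReal_mul (norm_nonneg _)]
  exact ENNReal.ofReal_le_ofReal (norm_inner_le_norm x y)

theorem enorm_sq_eq_ofReal {E : Type*} [SeminormedAddCommGroup E] (x : E) :
    ‖x‖ₑ ^ 2 = ENNReal.ofReal (‖x‖ ^ 2) := by
  rw [← ofReal_norm, ENNReal.ofReal_pow (norm_nonneg _)]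

/-- Bessel's inequality in `[0, ∞]`. -/
theorem tsum_enorm_inner_sq_le {ι : Type*} {v : ι → H} (hv : Orthonormal ℂ v) (x : H) :
    ∑' i, ‖⟪v i, x⟫_ℂ‖ₑ ^ 2 ≤ ‖x‖ₑ ^ 2 := by
  simp_rw [enorm_sq_eq_ofReal]
  rw [← ENNReal.ofReal_tsum_of_nonneg (fun _ => by positivity) (hv.inner_products_summable x)]
  exact ENNReal.ofReal_le_ofReal (hv.tsum_inner_products_le x)

theorem sum_enorm_inner_sq_le {ι : Type*} [Fintype ι] {v : ι → H} (hv : Orthonormal ℂ v) (x : H) :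
    ∑ i, ‖⟪v i, x⟫_ℂ‖ₑ ^ 2 ≤ ‖x‖ₑ ^ 2 := by
  simpa [tsum_fintype] using tsum_enorm_inner_sq_le hv x

/-- Parseval's identity in `[0, ∞]`. -/
theorem tsum_enorm_inner_sq {ι : Type*} (b : HilbertBasis ι ℂ H) (x : H) :
    ∑' i, ‖⟪b i, x⟫_ℂ‖ₑ ^ 2 = ‖x‖ₑ ^ 2 := by
  simp_rw [enorm_sq_eq_ofReal]
  rw [← ENNReal.ofReal_tsum_of_nonneg (fun _ => by positivity)
    (b.orthonormal.inner_products_summable x)]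
  congr 1
  have h := b.hasSum_inner_mul_inner x x
  have h2 := Complex.hasSum_re h
  rw [← h2.tsum_eq.trans (inner_self_eq_norm_sq (𝕜 := ℂ) x)]
  congr 1
  ext i
  rw [← inner_conj_symm x (b i), ← Complex.normSq_eq_conj_mul_self, Complex.ofReal_re,
    Complex.normSq_eq_norm_sq]

theorem exists_hilbertBasis_countable [CompleteSpace H] [TopologicalSpace.SeparableSpace H] :
    ∃ w : Set H, Countable w ∧ Nonempty (HilbertBasis w ℂ H) := by
  obtain ⟨w, b, hb⟩ := exists_hilbertBasis ℂ H
  refine ⟨w, ?_, ⟨b⟩⟩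
  -- distinct basis vectors are at distance `√2`, so that balls of radius `1 / 2` are disjoint
  refine Pairwise.countable_of_isOpen_disjoint (s := fun i : w => Metric.ball (i : H) (1 / 2))
    ?_ (fun _ => Metric.isOpen_ball) (fun i => ⟨i, Metric.mem_ball_self (by norm_num)⟩)
  intro i j hij
  refine Metric.ball_disjoint_ball ?_
  have ho := b.orthonormal
  rw [hb] at ho
  have h2 : ‖(i : H) - j‖ ^ 2 = 2 := by
    have e := norm_sub_sq (𝕜 := ℂ) (i : H) (j : H)
    rw [ho.2 hij] at e
    have hi := ho.1 i
    have hj := ho.1 j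
    rw [e, hi, hj]
    norm_num
  rw [dist_eq_norm]
  nlinarith [norm_nonneg ((i : H) - j)]

theorem sum_le_formTrace (q : H → ℝ≥0∞) {ι : Type*} [Fintype ι] {e : ι → H}
    (he : Orthonormal ℂ e) : ∑ i, q (e i) ≤ formTrace q := by
  let σ := Fintype.equivFin ι
  have h : Orthonormal ℂ (e ∘ σ.symm) := he.comp _ σ.symm.injective
  calc ∑ i, q (e i) = ∑ k, q ((e ∘ σ.symm) k) := (Equiv.sum_comp σ.symm fun i => q (e i)).symm
    _ ≤ _ := le_iSup_of_le (Fintype.card ι) (le_iSup₂_of_le (f := fun (e : Fin _ → H)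
        (_ : Orthonormal ℂ e) => ∑ i, q (e i)) (e ∘ σ.symm) h le_rfl)

theorem tsum_le_formTrace (q : H → ℝ≥0∞) {ι : Type*} {e : ι → H} (he : Orthonormal ℂ e) :
    ∑' i, q (e i) ≤ formTrace q := by
  rw [ENNReal.tsum_eq_iSup_sum]
  refine iSup_le fun s => ?_
  rw [← Finset.sum_coe_sort s]
  exact sum_le_formTrace q (he.comp _ Subtype.val_injective)

theorem formTrace_le {q : H → ℝ≥0∞} {C : ℝ≥0∞}
    (h : ∀ (n : ℕ) (e : Fin n → H), Orthonormal ℂ e → ∑ i, q (e i) ≤ C) : formTrace q ≤ C :=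
  iSup_le fun n => iSup_le fun e => iSup_le fun he => h n e he

variable [CompleteSpace H]

/-- The positive square root of a positive bounded operator. It is the one used in `sandwichTrace`,
in a form that can be applied to operators on concrete `L²` spaces without searching for functional
calculus instances there. -/
noncomputable def opSqrt (A : H →L[ℂ] H) : H →L[ℂ] H := CFC.sqrt A

theorem sandwichTrace_eq (q : H → ℝ≥0∞) (A : H →L[ℂ] H) :
    sandwichTrace q A = formTrace fun e => q (opSqrt A e) := rfl

theorem opSqrt_mul_self {A : H →L[ℂ] H} (hA : 0 ≤ A) : opSqrt A * opSqrt A = A :=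
  CFC.sqrt_mul_sqrt_self A hA

theorem isSelfAdjoint_opSqrt (A : H →L[ℂ] H) : IsSelfAdjoint (opSqrt A) :=
  (CFC.sqrt_nonneg A).isSelfAdjoint

theorem inner_opSqrt_left (A : H →L[ℂ] H) (x y : H) :
    ⟪opSqrt A x, y⟫_ℂ = ⟪x, opSqrt A y⟫_ℂ := by
  rw [← ContinuousLinearMap.adjoint_inner_right, (isSelfAdjoint_opSqrt A).adjoint_eq]

theorem inner_eq_inner_opSqrt {A : H →L[ℂ] H} (hA : 0 ≤ A) (x y : H) :
    ⟪x, A y⟫_ℂ = ⟪opSqrt A x, opSqrt A y⟫_ℂ := by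
  conv_lhs => rw [← opSqrt_mul_self hA]
  rw [inner_opSqrt_left]
  rfl

theorem quadForm_eq_enorm_opSqrt {A : H →L[ℂ] H} (hA : 0 ≤ A) (x : H) :
    quadForm A x = ‖opSqrt A x‖ₑ ^ 2 := by
  rw [quadForm, inner_eq_inner_opSqrt hA, enorm_sq_eq_ofReal]
  congr 1
  exact inner_self_eq_norm_sq (𝕜 := ℂ) _

theorem quadForm_smul {A : H →L[ℂ] H} (hA : 0 ≤ A) (c : ℂ) (x : H) :
    quadForm A (c • x) = ‖c‖ₑ ^ 2 * quadForm A x := by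
  simp [quadForm_eq_enorm_opSqrt hA, enorm_smul, mul_pow]

theorem opTrace_eq_tsum {A : H →L[ℂ] H} (hA : 0 ≤ A) {ι : Type*} (b : HilbertBasis ι ℂ H) :
    opTrace A = ∑' i, quadForm A (b i) := by
  refine le_antisymm (formTrace_le fun n e he => ?_) (tsum_le_formTrace _ b.orthonormal)
  simp_rw [quadForm_eq_enorm_opSqrt hA]
  calc ∑ i, ‖opSqrt A (e i)‖ₑ ^ 2
      = ∑ i, ∑' k, ‖⟪e i, opSqrt A (b k)⟫_ℂ‖ₑ ^ 2 := by
        refine Finset.sum_congr rfl fun i _ => ?_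
        rw [← tsum_enorm_inner_sq b]
        refine tsum_congr fun k => ?_
        rw [← inner_opSqrt_left, enorm_inner_comm]
    _ = ∑' k, ∑ i, ‖⟪e i, opSqrt A (b k)⟫_ℂ‖ₑ ^ 2 :=
        (Summable.tsum_finsetSum fun _ _ => ENNReal.summable).symm
    _ ≤ _ := ENNReal.tsum_le_tsum fun k => sum_enorm_inner_sq_le he _

theorem quadForm_le_opTrace {A : H →L[ℂ] H} (hA : 0 ≤ A) (x : H) :
    quadForm A x ≤ opTrace A * ‖x‖ₑ ^ 2 := by
  by_cases hx : x = 0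
  · simp [hx, quadForm]
  have h1 : ‖(‖x‖⁻¹ : ℂ) • x‖ = 1 := by
    rw [norm_smul, norm_inv, Complex.norm_real, norm_norm, inv_mul_cancel₀ (norm_ne_zero_iff.2 hx)]
  have ho : Orthonormal ℂ (fun _ : Fin 1 => (‖x‖⁻¹ : ℂ) • x) :=
    ⟨fun _ => h1, fun i j hij => absurd (Subsingleton.elim i j) hij⟩
  have h2 := sum_le_formTrace (quadForm A) ho
  have h3 : x = (‖x‖ : ℂ) • (‖x‖⁻¹ : ℂ) • x := by
    rw [smul_smul, mul_inv_cancel₀ (by simpa using hx), one_smul]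
  conv_lhs => rw [h3]
  rw [quadForm_smul hA, mul_comm]
  have h4 : ‖(‖x‖ : ℂ)‖ₑ = ‖x‖ₑ := by
    rw [← ofReal_norm, ← ofReal_norm, Complex.norm_real, norm_norm]
  rw [h4]
  gcongr
  simpa [opTrace] using h2

/-- The matrix elements of a positive operator are bounded by its trace. -/
theorem enorm_inner_le_opTrace {A : H →L[ℂ] H} (hA : 0 ≤ A) (x y : H) :
    ‖⟪x, A y⟫_ℂ‖ₑ ≤ opTrace A * (‖x‖ₑ * ‖y‖ₑ) := by
  rw [inner_eq_inner_opSqrt hA]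
  refine (enorm_inner_le_enorm _ _).trans ?_
  rw [← ENNReal.pow_le_pow_left_iff (n := 2) two_ne_zero, mul_pow, mul_pow, mul_pow,
    ← quadForm_eq_enorm_opSqrt hA, ← quadForm_eq_enorm_opSqrt hA]
  calc _ ≤ (opTrace A * ‖x‖ₑ ^ 2) * (opTrace A * ‖y‖ₑ ^ 2) :=
        mul_le_mul' (quadForm_le_opTrace hA x) (quadForm_le_opTrace hA y)
    _ = _ := by ring

variable {K : Type*} [NormedAddCommGroup K] [InnerProductSpace ℂ K] [CompleteSpace K]

theorem conj_adjoint_nonneg {A : H →L[ℂ] H} (hA : 0 ≤ A) (V : H →L[ℂ] K) :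
    0 ≤ V ∘L A ∘L V.adjoint :=
  (ContinuousLinearMap.nonneg_iff_isPositive _).2
    (((ContinuousLinearMap.nonneg_iff_isPositive _).1 hA).conj_adjoint V)

theorem quadForm_conj_adjoint (A : H →L[ℂ] H) (V : H →L[ℂ] K) (s : K) :
    quadForm (V ∘L A ∘L V.adjoint) s = quadForm A (V.adjoint s) := by
  simp [quadForm, ← ContinuousLinearMap.adjoint_inner_left]

/-- The quadratic form of `V A V†` as a sum of squares, from `A = ∑ₖ |√A bₖ⟩⟨√A bₖ|`. -/
theorem quadForm_conj_adjoint_eq_tsum {A : H →L[ℂ] H} (hA : 0 ≤ A) (V : H →L[ℂ] K)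
    {ι : Type*} (b : HilbertBasis ι ℂ H) (s : K) :
    quadForm (V ∘L A ∘L V.adjoint) s = ∑' k, ‖⟪V (opSqrt A (b k)), s⟫_ℂ‖ₑ ^ 2 := by
  rw [quadForm_conj_adjoint, quadForm_eq_enorm_opSqrt hA, ← tsum_enorm_inner_sq b]
  refine tsum_congr fun k => ?_
  rw [← inner_opSqrt_left, ContinuousLinearMap.adjoint_inner_right]

theorem opTrace_conj_adjoint {A : H →L[ℂ] H} (hA : 0 ≤ A) {V : H →L[ℂ] K}
    (hV : ∀ x, ‖V x‖ = ‖x‖) : opTrace (V ∘L A ∘L V.adjoint) = opTrace A := by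
  obtain ⟨_, b, -⟩ := exists_hilbertBasis ℂ H
  obtain ⟨_, c, -⟩ := exists_hilbertBasis ℂ K
  rw [opTrace_eq_tsum (conj_adjoint_nonneg hA V) c, opTrace_eq_tsum hA b]
  simp_rw [quadForm_conj_adjoint_eq_tsum hA V b]
  rw [ENNReal.tsum_comm]
  refine tsum_congr fun k => ?_
  rw [quadForm_eq_enorm_opSqrt hA]
  simp_rw [enorm_inner_comm (V _)]
  rw [tsum_enorm_inner_sq c, ← ofReal_norm, ← ofReal_norm, hV]

end Trace

/-! ### Traces of unbounded forms by duality -/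

section Dual

variable {H : Type*} [NormedAddCommGroup H] [InnerProductSpace ℂ H]
  {F : Type*} [AddCommGroup F] [Module ℂ F]

/-- A dense subspace tests norms of finitely many vectors at once, through finite orthonormal
families it contains. -/
theorem sum_enorm_sq_le_of_dense {J : F →ₗ[ℂ] H} (hJ : DenseRange J) {n : ℕ} (g : Fin n → H)
    {M : ℝ≥0∞}
    (h : ∀ (m : ℕ) (φ : Fin m → F), Orthonormal ℂ (fun k => J (φ k)) →
      ∑ i, ∑ k, ‖⟪J (φ k), g i⟫_ℂ‖ₑ ^ 2 ≤ M) :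
    ∑ i, ‖g i‖ₑ ^ 2 ≤ M := by
  let U : Finset F → Submodule ℂ H := fun t => Submodule.span ℂ (J '' (t : Set F))
  have hfin (t : Finset F) : FiniteDimensional ℂ (U t) :=
    FiniteDimensional.span_of_finite ℂ (t.finite_toSet.image J)
  have hmono : Monotone U := fun s t hst =>
    Submodule.span_mono (Set.image_mono (Finset.coe_subset.2 hst))
  have hsup : ⊤ ≤ (⨆ t, U t).topologicalClosure := by
    intro x _
    have hle : Set.range J ⊆ ((⨆ t, U t : Submodule ℂ H) : Set H) := by
      rintro _ ⟨φ, rfl⟩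
      exact (le_iSup U {φ}) (Submodule.subset_span ⟨φ, by simp, rfl⟩)
    exact closure_mono hle (hJ x)
  have hlim : Filter.Tendsto (fun t => ∑ i, ‖(U t).starProjection (g i)‖ₑ ^ 2) Filter.atTop
      (nhds (∑ i, ‖g i‖ₑ ^ 2)) :=
    tendsto_finsetSum _ fun i _ => (ENNReal.continuous_pow 2).tendsto _ |>.comp
      ((continuous_enorm.tendsto _).comp
        (Submodule.starProjection_tendsto_self U hmono (g i) hsup))
  refine le_of_tendsto' hlim fun t => ?_
  let b := stdOrthonormalBasis ℂ (U t)
  have hmem (k) : ∃ φ, J φ = (b k : H) := by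
    have : U t ≤ LinearMap.range J := Submodule.span_le.2 (by rintro _ ⟨φ, -, rfl⟩; exact ⟨φ, rfl⟩)
    exact this (b k).2
  choose φ hφ using hmem
  have hb : Orthonormal ℂ (fun k => (b k : H)) := b.orthonormal.comp_linearIsometry (U t).subtypeₗᵢ
  refine le_trans (le_of_eq (Finset.sum_congr rfl fun i _ => ?_)) (h _ φ (by simpa [hφ] using hb))
  have e1 : ‖(U t).starProjection (g i)‖ₑ = ‖(U t).orthogonalProjectionOnto (g i)‖ₑ := rfl
  rw [e1, ← tsum_enorm_inner_sq b.toHilbertBasis, tsum_fintype]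
  refine Finset.sum_congr rfl fun k _ => ?_
  rw [hφ]
  simp

variable [CompleteSpace H]

/-- Duality bound for traces. The linear maps `J` (with dense range) and `T` on a space `F` of test
vectors encode an unbounded operator `D`: the relation `g = D ψ` means `⟪J φ, g⟫ = ⟪T φ, ψ⟫` for
all `φ`. If the quadratic form of `γ` is a superposition of forms `Q ω` of operators
`∑ₗ |Φₗ⟩⟨Φₗ|` with `∑ₗ ‖D Φₗ‖² ≤ N ω`, then `Tr (γ^{1/2} D*D γ^{1/2}) ≤ ∫ N`. Only Bessel's
inequality is used: pairing with orthonormal test vectors moves `D` and `γ^{1/2}` onto them. -/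
theorem exists_dual_sum_le {Ω : Type*} [MeasurableSpace Ω] {μ : Measure Ω}
    {J T : F →ₗ[ℂ] H} (hJ : DenseRange J) {γ : H →L[ℂ] H} (hγ : 0 ≤ γ)
    {Q : Ω → H → ℝ≥0∞} (hQm : ∀ s, Measurable fun ω => Q ω s)
    (hQ : ∀ s, quadForm γ s = ∫⁻ ω, Q ω s ∂μ) {N : Ω → ℝ≥0∞} {ι : Type*}
    (hN : ∀ ω, N ω ≠ ∞ → ∃ Φ : ι → H,
      (∀ φ, Q ω (T φ) = ∑' l, ‖⟪Φ l, J φ⟫_ℂ‖ₑ ^ 2) ∧ ∑' l, ‖Φ l‖ₑ ^ 2 ≤ N ω)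
    (hfin : ∫⁻ ω, N ω ∂μ ≠ ∞) {n : ℕ} {e : Fin n → H} (he : Orthonormal ℂ e) :
    ∃ g : Fin n → H, (∀ i φ, ⟪J φ, g i⟫_ℂ = ⟪T φ, opSqrt γ (e i)⟫_ℂ) ∧
      ∑ i, ‖g i‖ₑ ^ 2 ≤ ∫⁻ ω, N ω ∂μ := by
  have hQ1 (ω) (φ : F) : Q ω (T φ) ≤ ‖J φ‖ₑ ^ 2 * N ω ∨ N ω = ∞ := by
    by_cases hω : N ω = ∞
    · exact Or.inr hω
    obtain ⟨Φ, hΦ, hΦN⟩ := hN ω hω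
    left
    calc Q ω (T φ) ≤ ∑' l, ‖J φ‖ₑ ^ 2 * ‖Φ l‖ₑ ^ 2 := by
          rw [hΦ]
          refine ENNReal.tsum_le_tsum fun l => ?_
          rw [← mul_pow, mul_comm]
          exact pow_le_pow_left' (enorm_inner_le_enorm _ _) 2
      _ ≤ _ := by rw [ENNReal.tsum_mul_left]; gcongr
  have hQ2 (ω) (m : ℕ) (φ : Fin m → F) (hφ : Orthonormal ℂ fun k => J (φ k)) :
      ∑ k, Q ω (T (φ k)) ≤ N ω := by
    by_cases hω : N ω = ∞
    · simp [hω]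
    obtain ⟨Φ, hΦ, hΦN⟩ := hN ω hω
    refine le_trans ?_ hΦN
    simp_rw [hΦ]
    rw [← Summable.tsum_finsetSum fun _ _ => ENNReal.summable]
    refine ENNReal.tsum_le_tsum fun l => ?_
    simp_rw [enorm_inner_comm (Φ l)]
    exact sum_enorm_inner_sq_le hφ _
  have hbound (φ : F) (i : Fin n) :
      ‖⟪opSqrt γ (e i), T φ⟫_ℂ‖ ≤ √(∫⁻ ω, N ω ∂μ).toReal * ‖J φ‖ := by
    have h1 : ‖⟪opSqrt γ (e i), T φ⟫_ℂ‖ₑ ^ 2 ≤ ‖J φ‖ₑ ^ 2 * ∫⁻ ω, N ω ∂μ := by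
      calc ‖⟪opSqrt γ (e i), T φ⟫_ℂ‖ₑ ^ 2 ≤ quadForm γ (T φ) := by
            rw [quadForm_eq_enorm_opSqrt hγ, inner_opSqrt_left]
            refine pow_le_pow_left' ((enorm_inner_le_enorm _ _).trans (le_of_eq ?_)) 2
            rw [← ofReal_norm, he.1 i]
            simp
        _ = ∫⁻ ω, Q ω (T φ) ∂μ := hQ _
        _ ≤ ∫⁻ ω, ‖J φ‖ₑ ^ 2 * N ω ∂μ := by
            by_cases h0 : J φ = 0
            · -- `N` need not be measurable, so `{N = ∞}` need not be a null set; but `Q ω (T φ)` is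
              -- measurable, vanishes where `N ω < ∞`, and so any multiple of it is at most `N ω`
              have h2 : ∫⁻ ω, ∞ * Q ω (T φ) ∂μ ≤ ∫⁻ ω, N ω ∂μ := by
                refine lintegral_mono fun ω => ?_
                rcases hQ1 ω φ with h | h
                · have : Q ω (T φ) = 0 := by simpa [h0] using h
                  simp [this]
                · simp [h]
              rw [lintegral_const_mul _ (hQm _)] at h2
              have h3 : ∫⁻ ω, Q ω (T φ) ∂μ = 0 := by
                by_contra h3
                rw [ENNReal.top_mul h3] at h2
                exact hfin (top_le_iff.1 h2)
              rw [h3]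
              exact bot_le
            · refine lintegral_mono fun ω => ?_
              rcases hQ1 ω φ with h | h
              · exact h
              · simp [h, h0]
        _ = _ := lintegral_const_mul' _ _ (by finiteness)
    have h2 := ENNReal.toReal_mono (by finiteness) h1
    rw [ENNReal.toReal_mul, ENNReal.toReal_pow, ENNReal.toReal_pow, toReal_enorm, toReal_enorm]
      at h2
    refine abs_le_of_sq_le_sq' ?_ (by positivity) |>.2
    rw [mul_pow, Real.sq_sqrt ENNReal.toReal_nonneg]
    linarith
  let ℓ (i : Fin n) : F →ₗ[ℂ] ℂ := (innerₛₗ ℂ (opSqrt γ (e i))) ∘ₗ T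
  have key (i : Fin n) (φ : F) :
      ⟪J φ, (InnerProductSpace.toDual ℂ H).symm ((ℓ i).extendOfNorm J)⟫_ℂ =
        ⟪T φ, opSqrt γ (e i)⟫_ℂ := by
    rw [← inner_conj_symm, InnerProductSpace.toDual_symm_apply,
      LinearMap.extendOfNorm_eq hJ ⟨_, fun φ => hbound φ i⟩]
    exact inner_conj_symm _ _
  refine ⟨fun i => (InnerProductSpace.toDual ℂ H).symm ((ℓ i).extendOfNorm J), key, ?_⟩
  refine sum_enorm_sq_le_of_dense hJ _ fun m φ hφ => ?_
  simp_rw [key]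
  rw [Finset.sum_comm]
  calc ∑ k, ∑ i, ‖⟪T (φ k), opSqrt γ (e i)⟫_ℂ‖ₑ ^ 2
      ≤ ∑ k, ∫⁻ ω, Q ω (T (φ k)) ∂μ := by
        refine Finset.sum_le_sum fun k _ => ?_
        rw [← hQ, quadForm_eq_enorm_opSqrt hγ]
        simp_rw [← inner_opSqrt_left, enorm_inner_comm (opSqrt γ (T (φ k)))]
        exact sum_enorm_inner_sq_le he _
    _ = ∫⁻ ω, ∑ k, Q ω (T (φ k)) ∂μ := (lintegral_finsetSum _ fun k _ => hQm _).symm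
    _ ≤ _ := lintegral_mono fun ω => hQ2 ω m φ hφ

end Dual

variable {d : ℕ}

/-! ### Tensor products -/

theorem coeFn_tensor (χ φ : H1 d) :
    (tensor χ φ : Pos d × Pos d → ℂ) =ᵐ[volume] fun x => χ x.1 * φ x.2 :=
  MemLp.coeFn_toLp _

theorem inner_tensor (a b a' b' : H1 d) :
    ⟪tensor a b, tensor a' b'⟫_ℂ = ⟪a, a'⟫_ℂ * ⟪b, b'⟫_ℂ := by
  simp only [L2.inner_def]
  rw [← integral_prod_mul, ← Measure.volume_eq_prod]
  refine integral_congr_ae ?_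
  filter_upwards [coeFn_tensor a b, coeFn_tensor a' b'] with x h1 h2
  rw [h1, h2]
  simp only [RCLike.inner_apply, map_mul]
  ring

theorem norm_tensor (a b : H1 d) : ‖tensor a b‖ = ‖a‖ * ‖b‖ := by
  have h := inner_tensor a b a b
  simp only [inner_self_eq_norm_sq_to_K] at h
  refine (pow_left_inj₀ (norm_nonneg _) (by positivity) two_ne_zero).1 ?_
  rw [mul_pow]
  exact_mod_cast h

theorem ae_eq_comp_fst {χ χ' : Pos d → ℂ} (h : χ =ᵐ[volume] χ') :
    (fun x : Pos d × Pos d => χ x.1) =ᵐ[volume] fun x => χ' x.1 :=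
  Measure.quasiMeasurePreserving_fst.ae_eq_comp h

theorem ae_eq_comp_snd {χ χ' : Pos d → ℂ} (h : χ =ᵐ[volume] χ') :
    (fun x : Pos d × Pos d => χ x.2) =ᵐ[volume] fun x => χ' x.2 :=
  Measure.quasiMeasurePreserving_snd.ae_eq_comp h

/-- The tensor product as a bounded bilinear map. -/
noncomputable def tensorL : H1 d →L[ℂ] H1 d →L[ℂ] H2 d :=
  LinearMap.mkContinuous₂ (LinearMap.mk₂ ℂ tensor
    (fun a a' b => by
      refine Lp.ext ?_
      filter_upwards [coeFn_tensor (a + a') b, coeFn_tensor a b, coeFn_tensor a' b,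
        Lp.coeFn_add (tensor a b) (tensor a' b), ae_eq_comp_fst (Lp.coeFn_add a a')]
        with x h1 h2 h3 h4 h5
      simp only [h1, h4, h5, Pi.add_apply, h2, h3, add_mul])
    (fun c a b => by
      refine Lp.ext ?_
      filter_upwards [coeFn_tensor (c • a) b, coeFn_tensor a b,
        Lp.coeFn_smul c (tensor a b), ae_eq_comp_fst (Lp.coeFn_smul c a)] with x h1 h2 h3 h4
      simp only [h1, h3, h4, Pi.smul_apply, h2, smul_eq_mul, mul_assoc])
    (fun a b b' => by
      refine Lp.ext ?_
      filter_upwards [coeFn_tensor a (b + b'), coeFn_tensor a b, coeFn_tensor a b',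
        Lp.coeFn_add (tensor a b) (tensor a b'), ae_eq_comp_snd (Lp.coeFn_add b b')]
        with x h1 h2 h3 h4 h5
      simp only [h1, h4, h5, Pi.add_apply, h2, h3, mul_add])
    (fun c a b => by
      refine Lp.ext ?_
      filter_upwards [coeFn_tensor a (c • b), coeFn_tensor a b,
        Lp.coeFn_smul c (tensor a b), ae_eq_comp_snd (Lp.coeFn_smul c b)] with x h1 h2 h3 h4
      simp only [h1, h3, h4, Pi.smul_apply, h2, smul_eq_mul]
      ring)) 1 (fun a b => by simp [norm_tensor])

@[simp]
theorem tensorL_apply (a b : H1 d) : tensorL a b = tensor a b := rfl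

theorem adjoint_tensorL_tensor (ψ a b : H1 d) :
    (tensorL ψ).adjoint (tensor a b) = ⟪ψ, a⟫_ℂ • b := by
  refine ext_inner_left ℂ fun c => ?_
  rw [ContinuousLinearMap.adjoint_inner_right, tensorL_apply, inner_tensor, inner_smul_right]

/-! ### Test functions and weak momenta -/

section TestFunctions

variable (V : Type*) [NormedAddCommGroup V] [NormedSpace ℝ V]

/-- Smooth compactly supported complex functions on `V`. -/
def testFunctions : Submodule ℂ (V → ℂ) where
  carrier := {φ | ContDiff ℝ (⊤ : ℕ∞) φ ∧ HasCompactSupport φ}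
  add_mem' h h' := ⟨h.1.add h'.1, h.2.add h'.2⟩
  zero_mem' := ⟨contDiff_const, HasCompactSupport.zero⟩
  smul_mem' c _ h := ⟨h.1.const_smul c, h.2.smul_left (f := fun _ => c)⟩

variable {V}

theorem continuous_fderiv_apply {φ : V → ℂ} (h : ContDiff ℝ (⊤ : ℕ∞) φ) (v : V) :
    Continuous fun x => fderiv ℝ φ x v :=
  (h.continuous_fderiv (by simp)).clm_apply continuous_const

variable [MeasureSpace V] [BorelSpace V] [IsFiniteMeasureOnCompacts (volume : Measure V)]

theorem memLp_testFunction (φ : testFunctions V) : MemLp φ.1 2 (volume : Measure V) :=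
  φ.2.1.continuous.memLp_of_hasCompactSupport φ.2.2

theorem memLp_fderiv_testFunction (φ : testFunctions V) (v : V) :
    MemLp (fun x => fderiv ℝ φ.1 x v) 2 (volume : Measure V) :=
  (continuous_fderiv_apply φ.2.1 v).memLp_of_hasCompactSupport (φ.2.2.fderiv_apply ℝ v)

/-- The inclusion of test functions into `L²`. -/
noncomputable def testToL2 : testFunctions V →ₗ[ℂ] Lp ℂ 2 (volume : Measure V) where
  toFun φ := (memLp_testFunction φ).toLp _
  map_add' _ _ := rfl
  map_smul' _ _ := rfl

/-- `φ ↦ -iħ ∂_v φ` on test functions. -/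
noncomputable def testMomentum (ħ : ℝ) (v : V) :
    testFunctions V →ₗ[ℂ] Lp ℂ 2 (volume : Measure V) where
  toFun φ := ((memLp_fderiv_testFunction φ v).const_mul (-(Complex.I * ħ))).toLp _
  map_add' φ φ' := by
    rw [← MemLp.toLp_add]
    refine MemLp.toLp_congr _ _ (ae_of_all _ fun x => ?_)
    have h := fderiv_add (φ.2.1.differentiable (by simp) x) (φ'.2.1.differentiable (by simp) x)
    change _ * fderiv ℝ (φ.1 + φ'.1) x v = _
    rw [h]
    simp [mul_add]
  map_smul' c φ := by
    simp only [RingHom.id_apply]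
    rw [← MemLp.toLp_const_smul]
    refine MemLp.toLp_congr _ _ (ae_of_all _ fun x => ?_)
    have h := fderiv_const_smul (φ.2.1.differentiable (by simp) x) c
    change _ * fderiv ℝ (c • φ.1) x v = _
    rw [h]
    simp
    ring

theorem coeFn_testToL2 (φ : testFunctions V) :
    (testToL2 φ : V → ℂ) =ᵐ[volume] φ.1 :=
  (memLp_testFunction φ).coeFn_toLp

theorem coeFn_testMomentum (ħ : ℝ) (v : V) (φ : testFunctions V) :
    (testMomentum ħ v φ : V → ℂ) =ᵐ[volume] fun x => -(Complex.I * ħ) * fderiv ℝ φ.1 x v :=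
  ((memLp_fderiv_testFunction φ v).const_mul (-(Complex.I * ħ))).coeFn_toLp

theorem denseRange_testToL2 [FiniteDimensional ℝ V] : DenseRange (testToL2 (V := V)) := by
  refine (Lp.dense_hasCompactSupport_contDiff (F := ℂ) (μ := (volume : Measure V)) (p := 2)
    (by simp)).mono ?_
  rintro f ⟨g, hfg, hg, hg'⟩
  refine ⟨⟨g, hg', hg⟩, Lp.ext ?_⟩
  exact (coeFn_testToL2 _).trans hfg.symm

/-- `g = -iħ ∂_v ψ` weakly, in terms of the inner product with test functions. -/
theorem isMomentum_iff (ħ : ℝ) (v : V) (ψ g : Lp ℂ 2 (volume : Measure V)) :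
    IsMomentum ħ v ψ g ↔ ∀ φ, ⟪testToL2 φ, g⟫_ℂ = ⟪testMomentum ħ v φ, ψ⟫_ℂ := by
  have h1 (φ : testFunctions V) : ⟪testToL2 φ, g⟫_ℂ = ∫ x, g x * star (φ.1 x) := by
    rw [L2.inner_def]
    refine integral_congr_ae ?_
    filter_upwards [coeFn_testToL2 φ] with x hx
    rw [hx]
    rfl
  have hd (φ : testFunctions V) (x : V) :
      fderiv ℝ (fun y => star (φ.1 y)) x v = star (fderiv ℝ φ.1 x v) := by
    have h := (φ.2.1.differentiable (by simp) x).hasFDerivAt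
    have := (Complex.conjCLE.toContinuousLinearMap.hasFDerivAt (x := φ.1 x)).comp x h
    exact congrArg (· v) this.fderiv
  have h2 (φ : testFunctions V) : ⟪testMomentum ħ v φ, ψ⟫_ℂ =
      Complex.I * ħ * ∫ x, ψ x * fderiv ℝ (fun y => star (φ.1 y)) x v := by
    rw [L2.inner_def, ← integral_const_mul]
    refine integral_congr_ae ?_
    filter_upwards [coeFn_testMomentum ħ v φ] with x hx
    rw [hx, hd]
    simp only [RCLike.inner_apply, map_mul, map_neg, Complex.conj_I, Complex.conj_ofReal]
    simp only [starRingEnd_apply]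
    ring
  constructor
  · intro h φ
    rw [h1, h2]
    exact h _ (Complex.conjCLE.contDiff.comp φ.2.1) (φ.2.2.comp_left (g := star) (star_zero _))
  · intro h φ hφ hφ'
    have := h ⟨fun x => star (φ x), Complex.conjCLE.contDiff.comp hφ,
      hφ'.comp_left (g := star) (star_zero _)⟩
    rw [h1, h2] at this
    simpa using this

end TestFunctions

/-- The Leibniz rule for the relative momentum `p₁ - p₂` on tensor products. -/
theorem IsMomentum.tensor {ħ : ℝ} {v w : Pos d} {ψ a χ b : H1 d} (hψ : IsMomentum ħ v ψ a)
    (hχ : IsMomentum ħ w χ b) :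
    IsMomentum ħ ((v, -w) : Pos d × Pos d) (tensor ψ χ) (tensor a χ - tensor ψ b) := by
  intro φ hφ hφ'
  let Φ : testFunctions (Pos d × Pos d) := ⟨φ, hφ, hφ'⟩
  have hint (u u' : H1 d) {η : Pos d × Pos d → ℂ} (hη : MemLp η 2 volume) :
      Integrable fun x : Pos d × Pos d => u x.1 * u' x.2 * η x :=
    (memLp_tensor u u').integrable_mul hη
  have hφ2 : MemLp φ 2 (volume : Measure (Pos d × Pos d)) := memLp_testFunction Φ
  have hdφ (u : Pos d × Pos d) : MemLp (fun x => fderiv ℝ φ x u) 2 volume :=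
    memLp_fderiv_testFunction Φ u
  -- sections of test functions are test functions
  have hs1 (y : Pos d) : ContDiff ℝ (⊤ : ℕ∞) fun x => φ (x, y) := hφ.comp (by fun_prop)
  have hs2 (x : Pos d) : ContDiff ℝ (⊤ : ℕ∞) fun y => φ (x, y) := hφ.comp (by fun_prop)
  have hc1 (y : Pos d) : HasCompactSupport fun x => φ (x, y) :=
    hφ'.comp_isClosedEmbedding
      ⟨isEmbedding_prodMkLeft y, (isClosedMap_prodMk_right y).isClosed_range⟩
  have hc2 (x : Pos d) : HasCompactSupport fun y => φ (x, y) :=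
    hφ'.comp_isClosedEmbedding
      ⟨isEmbedding_prodMkRight x, (isClosedMap_prodMk_left x).isClosed_range⟩
  have hd1 (x y : Pos d) : fderiv ℝ (fun x => φ (x, y)) x v = fderiv ℝ φ (x, y) (v, 0) := by
    have h := (hφ.differentiable (by simp) (x, y)).hasFDerivAt.comp x
      (hasFDerivAt_prodMk_left (𝕜 := ℝ) x y)
    exact (congrArg (· v) h.fderiv).trans rfl
  have hd2 (x y : Pos d) : fderiv ℝ (fun y => φ (x, y)) y w = fderiv ℝ φ (x, y) (0, w) := by
    have h := (hφ.differentiable (by simp) (x, y)).hasFDerivAt.comp y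
      (hasFDerivAt_prodMk_right (𝕜 := ℝ) x y)
    exact (congrArg (· w) h.fderiv).trans rfl
  have e1 : ∫ x : Pos d × Pos d, a x.1 * χ x.2 * φ x =
      Complex.I * ħ * ∫ x : Pos d × Pos d, ψ x.1 * χ x.2 * fderiv ℝ φ x (v, 0) := by
    rw [Measure.volume_eq_prod, integral_prod_symm _ (hint a χ hφ2),
      integral_prod_symm _ (hint ψ χ (hdφ _)), ← integral_const_mul]
    refine integral_congr_ae (ae_of_all _ fun y => ?_)
    have h := hψ _ (hs1 y) (hc1 y)
    simp only [hd1] at h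
    calc ∫ x, a x * χ y * φ (x, y) = χ y * ∫ x, a x * φ (x, y) := by
          rw [← integral_const_mul]; congr 1; ext x; ring
      _ = Complex.I * ħ * (χ y * ∫ x, ψ x * fderiv ℝ φ (x, y) (v, 0)) := by rw [h]; ring
      _ = _ := by
          rw [← integral_const_mul]; congr 2; ext x; ring
  have e2 : ∫ x : Pos d × Pos d, ψ x.1 * b x.2 * φ x =
      Complex.I * ħ * ∫ x : Pos d × Pos d, ψ x.1 * χ x.2 * fderiv ℝ φ x (0, w) := by
    rw [Measure.volume_eq_prod, integral_prod _ (hint ψ b hφ2),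
      integral_prod _ (hint ψ χ (hdφ _)), ← integral_const_mul]
    refine integral_congr_ae (ae_of_all _ fun x => ?_)
    have h := hχ _ (hs2 x) (hc2 x)
    simp only [hd2] at h
    calc ∫ y, ψ x * b y * φ (x, y) = ψ x * ∫ y, b y * φ (x, y) := by
          rw [← integral_const_mul]; congr 1; ext x; ring
      _ = Complex.I * ħ * (ψ x * ∫ y, χ y * fderiv ℝ φ (x, y) (0, w)) := by rw [h]; ring
      _ = _ := by
          rw [← integral_const_mul]; congr 2; ext x; ring
  have h1 : ∫ x, (QOT.tensor a χ - QOT.tensor ψ b) x * φ x =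
      ∫ x : Pos d × Pos d, (a x.1 * χ x.2 * φ x - ψ x.1 * b x.2 * φ x) := by
    refine integral_congr_ae ?_
    filter_upwards [coeFn_tensor a χ, coeFn_tensor ψ b,
      Lp.coeFn_sub (QOT.tensor a χ) (QOT.tensor ψ b)] with x h1 h2 h3
    rw [h3, Pi.sub_apply, h1, h2, sub_mul]
  have h2 : ∫ x, QOT.tensor ψ χ x * fderiv ℝ φ x (v, -w) =
      ∫ x : Pos d × Pos d, (ψ x.1 * χ x.2 * fderiv ℝ φ x (v, 0) -
        ψ x.1 * χ x.2 * fderiv ℝ φ x (0, w)) := by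
    refine integral_congr_ae ?_
    filter_upwards [coeFn_tensor ψ χ] with x h1
    have : ((v, -w) : Pos d × Pos d) = (v, 0) - (0, w) := by simp
    rw [h1, this, map_sub, mul_sub]
  rw [h1, h2, integral_sub (hint _ _ hφ2) (hint _ _ hφ2), integral_sub (hint _ _ (hdφ _))
    (hint _ _ (hdφ _)), e1, e2, mul_sub]

/-! ### Gaussian moments -/

theorem integrable_gaussian {b : ℝ} (hb : 0 < b) (x : Pos d) :
    Integrable fun y : Pos d => Real.exp (-b * ‖y - x‖ ^ 2) := by
  have hb' : (0 : ℝ) < (b : ℂ).re := hb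
  have h := (GaussianFourier.integrable_cexp_neg_mul_sq_norm_add hb' 0 (0 : Pos d)).norm
  refine (h.comp_sub_right x).congr (ae_of_all _ fun y => ?_)
  simp only [Complex.norm_exp]
  congr 1
  simp [← Complex.ofReal_pow]

theorem integrable_sq_mul_gaussian {b : ℝ} (hb : 0 < b) (x : Pos d) :
    Integrable fun y : Pos d => ‖y - x‖ ^ 2 * Real.exp (-b * ‖y - x‖ ^ 2) := by
  refine ((integrable_gaussian (half_pos hb) x).const_mul (2 / b)).mono'
    (by fun_prop) (ae_of_all _ fun y => ?_)
  rw [Real.norm_of_nonneg (by positivity)]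
  have h1 := Real.add_one_le_exp (b / 2 * ‖y - x‖ ^ 2)
  have h2 : Real.exp (-b * ‖y - x‖ ^ 2) =
      Real.exp (-(b / 2) * ‖y - x‖ ^ 2) * (Real.exp (b / 2 * ‖y - x‖ ^ 2))⁻¹ := by
    rw [← Real.exp_neg, ← Real.exp_add]
    congr 1
    ring
  rw [h2]
  have h3 : ‖y - x‖ ^ 2 ≤ 2 / b * Real.exp (b / 2 * ‖y - x‖ ^ 2) := by
    have : ‖y - x‖ ^ 2 = 2 / b * (b / 2 * ‖y - x‖ ^ 2) := by field_simp
    rw [this]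
    gcongr
    rw [← this]
    linarith
  have h4 := Real.exp_pos (b / 2 * ‖y - x‖ ^ 2)
  have h5 := Real.exp_pos (-(b / 2) * ‖y - x‖ ^ 2)
  calc ‖y - x‖ ^ 2 * (Real.exp (-(b / 2) * ‖y - x‖ ^ 2) * (Real.exp (b / 2 * ‖y - x‖ ^ 2))⁻¹)
      ≤ 2 / b * Real.exp (b / 2 * ‖y - x‖ ^ 2) *
        (Real.exp (-(b / 2) * ‖y - x‖ ^ 2) * (Real.exp (b / 2 * ‖y - x‖ ^ 2))⁻¹) := by gcongr
    _ = _ := by field_simp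

theorem sq_coord_le (y : Pos d) (j : Fin d) : y j ^ 2 ≤ ‖y‖ ^ 2 := by
  rw [EuclideanSpace.real_norm_sq_eq]
  exact Finset.single_le_sum (f := fun i => y i ^ 2) (fun i _ => sq_nonneg _) (Finset.mem_univ j)

theorem continuous_coord_sub (x : Pos d) (j : Fin d) : Continuous fun y : Pos d => y j - x j := by
  fun_prop

theorem integrable_coord_sq_mul_gaussian {b : ℝ} (hb : 0 < b) (x : Pos d) (j : Fin d) :
    Integrable fun y : Pos d => (y j - x j) ^ 2 * Real.exp (-b * ‖y - x‖ ^ 2) := by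
  refine (integrable_sq_mul_gaussian hb x).mono' (by fun_prop) (ae_of_all _ fun y => ?_)
  rw [Real.norm_of_nonneg (by positivity)]
  exact mul_le_mul_of_nonneg_right (sq_coord_le (y - x) j) (Real.exp_pos _).le

theorem integrable_coord_mul_gaussian {b : ℝ} (hb : 0 < b) (x : Pos d) (j : Fin d) :
    Integrable fun y : Pos d => (y j - x j) * Real.exp (-b * ‖y - x‖ ^ 2) := by
  refine ((integrable_gaussian hb x).add (integrable_coord_sq_mul_gaussian hb x j)).mono'
    (by fun_prop) (ae_of_all _ fun y => ?_)
  rw [Real.norm_eq_abs, abs_mul, Real.abs_exp]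
  have : |y j - x j| ≤ 1 + (y j - x j) ^ 2 := by
    rw [abs_le]
    constructor <;> nlinarith [sq_nonneg (y j - x j - 1), sq_nonneg (y j - x j + 1)]
  calc _ ≤ (1 + (y j - x j) ^ 2) * Real.exp (-b * ‖y - x‖ ^ 2) := by gcongr
    _ = _ := by simp only [Pi.add_apply]; ring

theorem integral_gaussian_pos {b : ℝ} (hb : 0 < b) (x : Pos d) :
    ∫ y : Pos d, Real.exp (-b * ‖y - x‖ ^ 2) = (Real.pi / b) ^ ((d : ℝ) / 2) := by
  rw [integral_sub_right_eq_self (fun y : Pos d => Real.exp (-b * ‖y‖ ^ 2)),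
    GaussianFourier.integral_rexp_neg_mul_sq_norm hb]
  simp

theorem integral_coord_mul_gaussian (b : ℝ) (x : Pos d) (j : Fin d) :
    ∫ y : Pos d, (y j - x j) * Real.exp (-b * ‖y - x‖ ^ 2) = 0 := by
  have h1 := integral_sub_right_eq_self (μ := (volume : Measure (Pos d)))
    (fun y : Pos d => y j * Real.exp (-b * ‖y‖ ^ 2)) x
  simp only [PiLp.sub_apply] at h1
  rw [h1]
  have h2 := integral_neg_eq_self (fun y : Pos d => y j * Real.exp (-b * ‖y‖ ^ 2)) volume
  simp only [PiLp.neg_apply, norm_neg, neg_mul, integral_neg] at h2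
  simp only [neg_mul]
  linarith

theorem norm_add_smul_single_sq (w : Pos d) (j : Fin d) (t : ℝ) :
    ‖w + t • EuclideanSpace.single j (1 : ℝ)‖ ^ 2 = ‖w‖ ^ 2 + 2 * w j * t + t ^ 2 := by
  rw [norm_add_sq_real, inner_smul_right, norm_smul, EuclideanSpace.inner_single_right]
  simp
  ring

/-- Second moments of a Gaussian, by integrating the derivative of `(y_j - x_j) e^{-b|y - x|²}`. -/
theorem integral_coord_sq_mul_gaussian {b : ℝ} (hb : 0 < b) (x : Pos d) (j : Fin d) :
    ∫ y : Pos d, (y j - x j) ^ 2 * Real.exp (-b * ‖y - x‖ ^ 2) =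
      (2 * b)⁻¹ * ∫ y : Pos d, Real.exp (-b * ‖y - x‖ ^ 2) := by
  have h := integral_bilinear_hasLineDerivAt_right_eq_neg_left_of_integrable
    (μ := (volume : Measure (Pos d))) (B := ContinuousLinearMap.mul ℝ ℝ)
    (f := fun y : Pos d => Real.exp (-b * ‖y - x‖ ^ 2))
    (f' := fun y : Pos d => Real.exp (-b * ‖y - x‖ ^ 2) * (-b * (2 * (y j - x j))))
    (g := fun y : Pos d => y j - x j) (g' := fun _ => 1) (v := EuclideanSpace.single j (1 : ℝ))
    (by
      refine ((integrable_coord_sq_mul_gaussian hb x j).const_mul (-2 * b)).congr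
        (ae_of_all _ fun y => ?_)
      simp only [ContinuousLinearMap.mul_apply']
      ring)
    (by simpa using integrable_gaussian hb x)
    (by
      refine (integrable_coord_mul_gaussian hb x j).congr (ae_of_all _ fun y => ?_)
      simp only [ContinuousLinearMap.mul_apply']
      ring)
    (fun y _ => by
      have e : (fun t : ℝ => Real.exp (-b * ‖y + t • EuclideanSpace.single j (1 : ℝ) - x‖ ^ 2)) =
          fun t => Real.exp (-b * (‖y - x‖ ^ 2 + 2 * (y j - x j) * t + t ^ 2)) := by
        ext t
        rw [add_sub_right_comm, norm_add_smul_single_sq]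
        rfl
      unfold HasLineDerivAt
      rw [e]
      have h1 : HasDerivAt (fun t : ℝ => -b * (‖y - x‖ ^ 2 + 2 * (y j - x j) * t + t ^ 2))
          (-b * (2 * (y j - x j))) 0 := by
        have := ((((hasDerivAt_id (0 : ℝ)).const_mul (2 * (y j - x j))).const_add
          (‖y - x‖ ^ 2)).add ((hasDerivAt_id (0 : ℝ)).pow 2)).const_mul (-b)
        convert! this using 1
        simp
      simpa using h1.exp)
    (fun y _ => by
      unfold HasLineDerivAt
      have : HasDerivAt (fun t : ℝ => (y j - x j) + t) 1 0 := (hasDerivAt_id _).const_add _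
      convert! this using 1
      ext t
      simp
      ring)
  simp only [ContinuousLinearMap.mul_apply', mul_one] at h
  rw [h, ← integral_neg, ← integral_const_mul]
  congr 1
  ext y
  field_simp

/-! ### Coherent states -/

theorem norm_coherentFun {ħ : ℝ} (hħ : 0 < ħ) (z : Phase d) (y : Pos d) :
    ‖coherentFun ħ z y‖ =
      (Real.pi * ħ) ^ (-(d : ℝ) / 4) * Real.exp (-‖y - z.1‖ ^ 2 / (2 * ħ)) := by
  rw [coherentFun, norm_mul, mul_comm Complex.I, Complex.norm_exp_ofReal_mul_I, mul_one,
    Complex.norm_real, Real.norm_of_nonneg (by positivity)]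

theorem norm_coherentFun_sq {ħ : ℝ} (hħ : 0 < ħ) (z : Phase d) (y : Pos d) :
    ‖coherentFun ħ z y‖ ^ 2 =
      (Real.pi * ħ) ^ (-(d : ℝ) / 2) * Real.exp (-ħ⁻¹ * ‖y - z.1‖ ^ 2) := by
  rw [norm_coherentFun hħ, mul_pow, ← Real.exp_nat_mul, ← Real.rpow_natCast, ← Real.rpow_mul
    (by positivity)]
  congr 2
  · push_cast; ring
  · push_cast; field_simp

theorem integral_norm_coherentFun_sq {ħ : ℝ} (hħ : 0 < ħ) (z : Phase d) :
    ∫ y, ‖coherentFun ħ z y‖ ^ 2 = 1 := by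
  simp_rw [norm_coherentFun_sq hħ]
  rw [integral_const_mul, integral_gaussian_pos (inv_pos.2 hħ), div_inv_eq_mul,
    ← Real.rpow_add (by positivity)]
  simp [neg_div]

theorem coeFn_coherent {ħ : ℝ} (hħ : 0 < ħ) (z : Phase d) :
    (coherent hħ z : Pos d → ℂ) =ᵐ[volume] coherentFun ħ z :=
  MemLp.coeFn_toLp _

theorem inner_toLp_eq {V : Type*} [MeasureSpace V] {a b : V → ℂ}
    (ha : MemLp a 2 (volume : Measure V)) (hb : MemLp b 2 (volume : Measure V)) :
    ⟪ha.toLp a, hb.toLp b⟫_ℂ = ∫ x, b x * star (a x) := by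
  rw [L2.inner_def]
  refine integral_congr_ae ?_
  filter_upwards [ha.coeFn_toLp, hb.coeFn_toLp] with x h1 h2
  rw [h1, h2]
  rfl

theorem norm_toLp_sq {V : Type*} [MeasureSpace V] {a : V → ℂ}
    (ha : MemLp a 2 (volume : Measure V)) : ‖ha.toLp a‖ ^ 2 = ∫ x, ‖a x‖ ^ 2 := by
  have h := inner_toLp_eq ha ha
  rw [inner_self_eq_norm_sq_to_K] at h
  have h2 : ∀ x, a x * star (a x) = ((‖a x‖ ^ 2 : ℝ) : ℂ) := fun x => by
    rw [← starRingEnd_apply, Complex.mul_conj, Complex.normSq_eq_norm_sq]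
  simp_rw [h2] at h
  rw [integral_complex_ofReal] at h
  refine Complex.ofReal_injective ?_
  rw [← h, Complex.ofReal_pow]
  rfl

@[simp]
theorem norm_coherent {ħ : ℝ} (hħ : 0 < ħ) (z : Phase d) : ‖coherent hħ z‖ = 1 := by
  have h := norm_toLp_sq (memLp_coherentFun hħ z)
  rw [integral_norm_coherentFun_sq hħ] at h
  exact (pow_eq_one_iff_of_nonneg (norm_nonneg _) two_ne_zero).1 h

theorem integrable_coherentFun {ħ : ℝ} (hħ : 0 < ħ) (z : Phase d) :
    Integrable (coherentFun ħ z) := by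
  have hc : Continuous (coherentFun ħ z) := by unfold coherentFun; fun_prop
  refine ((integrable_gaussian (inv_pos.2 (mul_pos two_pos hħ)) z.1).const_mul
    ((Real.pi * ħ) ^ (-(d : ℝ) / 4))).mono' hc.aestronglyMeasurable (ae_of_all _ fun y => ?_)
  rw [norm_coherentFun hħ]
  refine le_of_eq ?_
  congr 2
  field_simp

/-- Weak continuity, together with `‖ψ_z‖ = 1`, gives norm continuity. -/
theorem continuous_coherent {ħ : ℝ} (hħ : 0 < ħ) :
    Continuous (fun z : Phase d => coherent hħ z) := by
  refine continuous_iff_continuousAt.2 fun z₀ => ?_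
  have h1 : Continuous fun z : Phase d => ⟪coherent hħ z₀, coherent hħ z⟫_ℂ := by
    simp only [coherent, inner_toLp_eq]
    refine continuous_of_dominated (bound := fun y =>
      (Real.pi * ħ) ^ (-(d : ℝ) / 4) * ‖coherentFun ħ z₀ y‖) (fun z => ?_) (fun z => ?_) ?_ ?_
    · exact ((integrable_coherentFun hħ z).aestronglyMeasurable).mul
        (integrable_coherentFun hħ z₀).aestronglyMeasurable.star
    · refine ae_of_all _ fun y => ?_
      rw [norm_mul, norm_star, norm_coherentFun hħ z]
      gcongr
      refine mul_le_of_le_one_right (by positivity) (Real.exp_le_one_iff.2 ?_)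
      exact div_nonpos_of_nonpos_of_nonneg (by simp) (by positivity)
    · exact (integrable_coherentFun hħ z₀).norm.const_mul _
    · refine ae_of_all _ fun y => ?_
      unfold coherentFun
      fun_prop
  have h2 : Filter.Tendsto (fun z : Phase d => ‖coherent hħ z₀ - coherent hħ z‖ ^ 2) (nhds z₀)
      (nhds 0) := by
    have h3 : ∀ z, ‖coherent hħ z₀ - coherent hħ z‖ ^ 2 =
        2 - 2 * (⟪coherent hħ z₀, coherent hħ z⟫_ℂ).re := fun z => by
      rw [@norm_sub_sq ℂ, norm_coherent, norm_coherent]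
      simp only [RCLike.re_to_complex]
      ring
    simp_rw [h3]
    have h4 : Continuous fun z : Phase d => 2 - 2 * (⟪coherent hħ z₀, coherent hħ z⟫_ℂ).re := by
      fun_prop
    have h5 := h4.tendsto z₀
    rwa [← h3, sub_self, norm_zero, zero_pow two_ne_zero] at h5
  refine tendsto_iff_norm_sub_tendsto_zero.2 ?_
  have h6 := (Real.continuous_sqrt.tendsto 0).comp h2
  simpa [Function.comp_def, Real.sqrt_sq, norm_sub_rev] using h6

theorem memLp_coord_mul_coherentFun {ħ : ℝ} (hħ : 0 < ħ) (z : Phase d) (j : Fin d) :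
    MemLp (fun y => ((y j - z.1 j : ℝ) : ℂ) * coherentFun ħ z y) 2
      (volume : Measure (Pos d)) := by
  have hc : Continuous (coherentFun ħ z) := by unfold coherentFun; fun_prop
  have hc2 : Continuous fun y : Pos d => ((y j - z.1 j : ℝ) : ℂ) * coherentFun ħ z y :=
    (Complex.continuous_ofReal.comp (continuous_coord_sub z.1 j)).mul hc
  rw [memLp_two_iff_integrable_sq_norm hc2.aestronglyMeasurable]
  refine ((integrable_coord_sq_mul_gaussian (inv_pos.2 hħ) z.1 j).const_mul
    ((Real.pi * ħ) ^ (-(d : ℝ) / 2))).congr (ae_of_all _ fun y => ?_)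
  simp only [norm_mul, mul_pow, norm_coherentFun_sq hħ, Complex.norm_real, Real.norm_eq_abs, sq_abs]
  ring

/-- The function `(y_j - x_j) ψ_z(y)`, where `z = (x, ξ)`. -/
noncomputable def coherentCoord {ħ : ℝ} (hħ : 0 < ħ) (z : Phase d) (j : Fin d) : H1 d :=
  (memLp_coord_mul_coherentFun hħ z j).toLp _

theorem norm_coherentCoord_sq {ħ : ℝ} (hħ : 0 < ħ) (z : Phase d) (j : Fin d) :
    ‖coherentCoord hħ z j‖ ^ 2 = ħ / 2 := by
  rw [coherentCoord, norm_toLp_sq]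
  have h (y : Pos d) : ‖((y j - z.1 j : ℝ) : ℂ) * coherentFun ħ z y‖ ^ 2 =
      (Real.pi * ħ) ^ (-(d : ℝ) / 2) *
        ((y j - z.1 j) ^ 2 * Real.exp (-ħ⁻¹ * ‖y - z.1‖ ^ 2)) := by
    simp only [norm_mul, mul_pow, norm_coherentFun_sq hħ, Complex.norm_real, Real.norm_eq_abs,
      sq_abs]
    ring
  have h1 := integral_norm_coherentFun_sq hħ z
  simp_rw [norm_coherentFun_sq hħ] at h1
  rw [integral_const_mul] at h1
  simp_rw [h]
  rw [integral_const_mul, integral_coord_sq_mul_gaussian (inv_pos.2 hħ), mul_left_comm, h1]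
  field_simp

theorem inner_coherentCoord_coherent {ħ : ℝ} (hħ : 0 < ħ) (z : Phase d) (j : Fin d) :
    ⟪coherentCoord hħ z j, coherent hħ z⟫_ℂ = 0 := by
  rw [coherentCoord, coherent, inner_toLp_eq]
  have h (y : Pos d) : coherentFun ħ z y * star (((y j - z.1 j : ℝ) : ℂ) * coherentFun ħ z y) =
      (((Real.pi * ħ) ^ (-(d : ℝ) / 2) *
        ((y j - z.1 j) * Real.exp (-ħ⁻¹ * ‖y - z.1‖ ^ 2)) : ℝ) : ℂ) := by
    have e : coherentFun ħ z y * star (coherentFun ħ z y) =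
        ((‖coherentFun ħ z y‖ ^ 2 : ℝ) : ℂ) := by
      rw [← starRingEnd_apply, Complex.mul_conj, Complex.normSq_eq_norm_sq]
    rw [norm_coherentFun_sq hħ] at e
    rw [star_mul', mul_left_comm, e]
    simp only [← starRingEnd_apply, Complex.conj_ofReal]
    push_cast
    ring
  simp_rw [h]
  rw [integral_complex_ofReal, integral_const_mul, integral_coord_mul_gaussian]
  simp

theorem hasLineDerivAt_coherentFun {ħ : ℝ} (hħ : 0 < ħ) (z : Phase d) (j : Fin d) (y : Pos d) :
    HasLineDerivAt ℝ (coherentFun ħ z)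
      (((-(y j - z.1 j) / ħ : ℝ) + Complex.I * (z.2 j / ħ : ℝ)) * coherentFun ħ z y) y
      (EuclideanSpace.single j (1 : ℝ)) := by
  unfold HasLineDerivAt
  have e : (fun t : ℝ => coherentFun ħ z (y + t • EuclideanSpace.single j (1 : ℝ))) = fun t : ℝ =>
      coherentFun ħ z y * Complex.exp (((-(2 * (y j - z.1 j) * t + t ^ 2) / (2 * ħ) : ℝ) : ℂ) +
        Complex.I * ((z.2 j / ħ * t : ℝ) : ℂ)) := by
    ext t
    simp only [coherentFun]
    rw [add_sub_right_comm, norm_add_smul_single_sq, add_sub_right_comm, inner_add_right,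
      inner_smul_right, EuclideanSpace.inner_single_right]
    push_cast
    simp only [mul_assoc, ← Complex.exp_add]
    congr 2
    simp
    field_simp
    ring
  rw [e]
  have h1 : HasDerivAt (fun t : ℝ => -(2 * (y j - z.1 j) * t + t ^ 2) / (2 * ħ))
      (-(y j - z.1 j) / ħ) 0 := by
    have := ((((hasDerivAt_id (0 : ℝ)).const_mul (2 * (y j - z.1 j))).add
      ((hasDerivAt_id (0 : ℝ)).pow 2)).neg).div_const (2 * ħ)
    convert! this using 1
    simp
    field_simp
    ring
  have h2 : HasDerivAt (fun t : ℝ => z.2 j / ħ * t) (z.2 j / ħ) 0 := by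
    simpa using (hasDerivAt_id (0 : ℝ)).const_mul (z.2 j / ħ)
  have h3 := ((h1.ofReal_comp.add (h2.ofReal_comp.const_mul Complex.I)).cexp).const_mul
    (coherentFun ħ z y)
  convert! h3 using 1
  simp
  ring

/-- `-iħ ∂_j ψ_z = (ξ_j + i (y_j - x_j)) ψ_z`. -/
theorem isMomentum_coherent {ħ : ℝ} (hħ : 0 < ħ) (z : Phase d) (j : Fin d) :
    IsMomentum ħ (EuclideanSpace.single j (1 : ℝ)) (coherent hħ z)
      ((z.2 j : ℂ) • coherent hħ z + Complex.I • coherentCoord hħ z j) := by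
  intro φ hφ hφ'
  let Φ : testFunctions (Pos d) := ⟨φ, hφ, hφ'⟩
  have i1 : Integrable fun y => coherentFun ħ z y * φ y :=
    (memLp_coherentFun hħ z).integrable_mul (memLp_testFunction Φ)
  have i2 : Integrable fun y => coherentFun ħ z y *
      fderiv ℝ φ y (EuclideanSpace.single j (1 : ℝ)) :=
    (memLp_coherentFun hħ z).integrable_mul (memLp_fderiv_testFunction Φ _)
  have i3 : Integrable fun y => ((y j - z.1 j : ℝ) : ℂ) * coherentFun ħ z y * φ y :=
    (memLp_coord_mul_coherentFun hħ z j).integrable_mul (memLp_testFunction Φ)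
  have h := integral_bilinear_hasLineDerivAt_right_eq_neg_left_of_integrable
    (μ := (volume : Measure (Pos d))) (B := ContinuousLinearMap.mul ℝ ℂ)
    (f := coherentFun ħ z) (g := φ) (v := EuclideanSpace.single j (1 : ℝ))
    (f' := fun y => ((-(y j - z.1 j) / ħ : ℝ) + Complex.I * (z.2 j / ħ : ℝ)) * coherentFun ħ z y)
    (g' := fun y => fderiv ℝ φ y (EuclideanSpace.single j (1 : ℝ)))
    (by
      refine ((i3.const_mul (-(1 / ħ : ℂ))).add (i1.const_mul (Complex.I * (z.2 j / ħ)))).congr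
        (ae_of_all _ fun y => ?_)
      simp only [ContinuousLinearMap.mul_apply', Pi.add_apply]
      push_cast
      ring)
    i2 i1 (fun y _ => hasLineDerivAt_coherentFun hħ z j y)
    (fun y _ => (hφ.differentiable (by simp) y).hasFDerivAt.hasLineDerivAt _)
  simp only [ContinuousLinearMap.mul_apply'] at h
  have hr : ∫ y, coherent hħ z y * fderiv ℝ φ y (EuclideanSpace.single j (1 : ℝ)) =
      ∫ y, coherentFun ħ z y * fderiv ℝ φ y (EuclideanSpace.single j (1 : ℝ)) := by
    refine integral_congr_ae ?_
    filter_upwards [coeFn_coherent hħ z] with y h1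
    rw [h1]
  rw [hr, h, ← integral_neg, ← integral_const_mul]
  refine integral_congr_ae ?_
  filter_upwards [coeFn_coherent hħ z, (memLp_coord_mul_coherentFun hħ z j).coeFn_toLp,
    Lp.coeFn_add ((z.2 j : ℂ) • coherent hħ z) (Complex.I • coherentCoord hħ z j),
    Lp.coeFn_smul (z.2 j : ℂ) (coherent hħ z), Lp.coeFn_smul Complex.I (coherentCoord hħ z j)]
    with y h1 h2 h3 h4 h5
  have h2' : coherentCoord hħ z j y = ((y j - z.1 j : ℝ) : ℂ) * coherentFun ħ z y := h2
  rw [h3, Pi.add_apply, h4, h5, Pi.smul_apply, Pi.smul_apply, h1, h2', smul_eq_mul, smul_eq_mul]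
  have hne : (ħ : ℂ) ≠ 0 := by exact_mod_cast hħ.ne'
  push_cast
  field_simp
  ring_nf
  simp only [Complex.I_sq]
  ring

/-! ### Weak integrals of positive operators -/

section OperatorIntegral

variable {H : Type*} [NormedAddCommGroup H] [InnerProductSpace ℂ H]
  {Ω : Type*} [MeasurableSpace Ω] {μ : Measure Ω}

theorem measurable_quadForm {G : Ω → H →L[ℂ] H} {s : H}
    (hm : Measurable fun ω => ⟪s, G ω s⟫_ℂ) : Measurable fun ω => quadForm (G ω) s :=
  (Complex.measurable_re.comp hm).ennreal_ofReal

/-- Matrix elements of a weakly measurable operator field between continuous vector fields are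
measurable. -/
theorem measurable_inner_apply [SecondCountableTopology H] [TopologicalSpace Ω] [BorelSpace Ω]
    {A : Ω → H →L[ℂ] H} (hm : ∀ u v, Measurable fun ω => ⟪u, A ω v⟫_ℂ) {a b : Ω → H}
    (ha : Continuous a) (hb : Continuous b) : Measurable fun ω => ⟪a ω, A ω (b ω)⟫_ℂ := by
  borelize H
  have h := measurable_uncurry_of_continuous_of_measurable
    (u := fun (p : H × H) (ω : Ω) => ⟪p.1, A ω p.2⟫_ℂ)
    (fun ω => by fun_prop) (fun p => hm p.1 p.2)
  exact h.comp ((ha.measurable.prodMk hb.measurable).prodMk measurable_id)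

variable [CompleteSpace H]

theorem inner_self_eq_ofReal {A : H →L[ℂ] H} (hA : 0 ≤ A) (x : H) :
    ⟪x, A x⟫_ℂ = ((‖opSqrt A x‖ ^ 2 : ℝ) : ℂ) := by
  rw [inner_eq_inner_opSqrt hA, inner_self_eq_norm_sq_to_K]
  push_cast
  rfl

theorem lintegral_quadForm {G : Ω → H →L[ℂ] H} (hG : ∀ ω, 0 ≤ G ω) {s : H}
    (hi : Integrable (fun ω => ⟪s, G ω s⟫_ℂ) μ) :
    ∫⁻ ω, quadForm (G ω) s ∂μ = ENNReal.ofReal (∫ ω, ⟪s, G ω s⟫_ℂ ∂μ).re := by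
  have h1 : (∫ ω, ⟪s, G ω s⟫_ℂ ∂μ).re = ∫ ω, (⟪s, G ω s⟫_ℂ).re ∂μ := (integral_re hi).symm
  rw [h1]
  refine (ofReal_integral_eq_lintegral_ofReal hi.re (ae_of_all _ fun ω => ?_)).symm
  simp only [inner_self_eq_ofReal (hG ω)]
  rw [RCLike.re_to_complex, Complex.ofReal_re, Pi.zero_apply]
  positivity

/-- A weakly measurable field of positive operators with bounded traces has a weak integral. -/
theorem exists_operator_integral [IsFiniteMeasure μ] {G : Ω → H →L[ℂ] H} (hG : ∀ ω, 0 ≤ G ω)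
    (hm : ∀ u v, Measurable fun ω => ⟪u, G ω v⟫_ℂ) {C : ℝ≥0∞} (hC : C ≠ ∞)
    (hb : ∀ᵐ ω ∂μ, opTrace (G ω) ≤ C) :
    ∃ γ : H →L[ℂ] H, 0 ≤ γ ∧ ∀ s, quadForm γ s = ∫⁻ ω, quadForm (G ω) s ∂μ := by
  have hbd (u v : H) : ∀ᵐ ω ∂μ, ‖⟪u, G ω v⟫_ℂ‖ ≤ C.toReal * ‖u‖ * ‖v‖ := by
    filter_upwards [hb] with ω h
    have h1 := (enorm_inner_le_opTrace (hG ω) u v).trans (mul_le_mul_left h _)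
    have h2 := ENNReal.toReal_mono (by finiteness) h1
    simpa [mul_assoc] using h2
  have hint (u v : H) : Integrable (fun ω => ⟪u, G ω v⟫_ℂ) μ :=
    Integrable.of_bound (hm u v).aestronglyMeasurable _ (hbd u v)
  let B : H →L⋆[ℂ] H →L[ℂ] ℂ := LinearMap.mkContinuous₂
    (LinearMap.mk₂'ₛₗ (starRingEnd ℂ) (RingHom.id ℂ) (fun u v => ∫ ω, ⟪u, G ω v⟫_ℂ ∂μ)
      (fun u u' v => by
        simp only [inner_add_left]
        exact integral_add (hint _ _) (hint _ _))
      (fun c u v => by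
        simp only [inner_smul_left, integral_const_mul, smul_eq_mul])
      (fun u v v' => by
        simp only [map_add, inner_add_right]
        exact integral_add (hint _ _) (hint _ _))
      (fun c u v => by
        simp only [map_smul, inner_smul_right, integral_const_mul, smul_eq_mul, RingHom.id_apply]))
    (C.toReal * μ.real Set.univ)
    (fun u v => by
      refine (norm_integral_le_of_norm_le_const (hbd u v)).trans (le_of_eq ?_)
      ring)
  have hB (u v : H) : B u v = ∫ ω, ⟪u, G ω v⟫_ℂ ∂μ := rfl
  have hBself (x : H) : B x x = ((∫ ω, ‖opSqrt (G ω) x‖ ^ 2 ∂μ : ℝ) : ℂ) := by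
    rw [hB, ← integral_complex_ofReal]
    exact integral_congr_ae (ae_of_all _ fun ω => inner_self_eq_ofReal (hG ω) x)
  refine ⟨InnerProductSpace.continuousLinearMapOfBilin B, ?_, fun s => ?_⟩
  · rw [ContinuousLinearMap.nonneg_iff_isPositive, ContinuousLinearMap.isPositive_iff_complex]
    intro x
    rw [InnerProductSpace.continuousLinearMapOfBilin_apply, hBself]
    refine ⟨by simp, ?_⟩
    rw [RCLike.re_to_complex, Complex.ofReal_re]
    exact integral_nonneg fun ω => by positivity
  · rw [lintegral_quadForm hG (hint s s), ← hB, quadForm, ← inner_conj_symm, Complex.conj_re,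
      InnerProductSpace.continuousLinearMapOfBilin_apply]

variable {K : Type*} [NormedAddCommGroup K] [InnerProductSpace ℂ K] [CompleteSpace K]

/-- Traces of compressions commute with weak integrals. -/
theorem formTrace_compression_eq_lintegral {G : Ω → H →L[ℂ] H}
    (hm : ∀ u v, Measurable fun ω => ⟪u, G ω v⟫_ℂ) {γ : H →L[ℂ] H} (hγ : 0 ≤ γ)
    (hγG : ∀ s, quadForm γ s = ∫⁻ ω, quadForm (G ω) s ∂μ) (W : K →L[ℂ] H) {ι : Type*}
    [Countable ι] (b : HilbertBasis ι ℂ K) :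
    formTrace (fun χ => quadForm γ (W χ)) = ∫⁻ ω, ∑' k, quadForm (G ω) (W (b k)) ∂μ := by
  have h1 : formTrace (fun χ => quadForm γ (W χ)) = opTrace (W.adjoint ∘L γ ∘L W) := by
    unfold opTrace
    congr 1
    ext χ
    have := quadForm_conj_adjoint γ W.adjoint χ
    rw [ContinuousLinearMap.adjoint_adjoint] at this
    exact this.symm
  have h2 (χ : K) : quadForm (W.adjoint ∘L γ ∘L W) χ = quadForm γ (W χ) := by
    have := quadForm_conj_adjoint γ W.adjoint χ
    rwa [ContinuousLinearMap.adjoint_adjoint] at this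
  have h3 : 0 ≤ W.adjoint ∘L γ ∘L W := by
    have := conj_adjoint_nonneg hγ W.adjoint
    rwa [ContinuousLinearMap.adjoint_adjoint] at this
  rw [h1, opTrace_eq_tsum h3 b, lintegral_tsum fun k => (measurable_quadForm (hm _ _)).aemeasurable]
  simp_rw [h2, hγG]

theorem opTrace_eq_lintegral [TopologicalSpace.SeparableSpace H] {G : Ω → H →L[ℂ] H}
    (hG : ∀ ω, 0 ≤ G ω)
    (hm : ∀ u v, Measurable fun ω => ⟪u, G ω v⟫_ℂ) {γ : H →L[ℂ] H} (hγ : 0 ≤ γ)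
    (hγG : ∀ s, quadForm γ s = ∫⁻ ω, quadForm (G ω) s ∂μ) :
    opTrace γ = ∫⁻ ω, opTrace (G ω) ∂μ := by
  obtain ⟨w, hw, ⟨b⟩⟩ := exists_hilbertBasis_countable (H := H)
  simp_rw [opTrace_eq_tsum (hG _) b]
  exact formTrace_compression_eq_lintegral hm hγ hγG (ContinuousLinearMap.id ℂ H) b

theorem measurable_opTrace [TopologicalSpace.SeparableSpace H] {G : Ω → H →L[ℂ] H}
    (hG : ∀ ω, 0 ≤ G ω) (hm : ∀ u v, Measurable fun ω => ⟪u, G ω v⟫_ℂ) :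
    Measurable fun ω => opTrace (G ω) := by
  obtain ⟨w, hw, ⟨b⟩⟩ := exists_hilbertBasis_countable (H := H)
  simp_rw [opTrace_eq_tsum (hG _) b]
  exact Measurable.tsum fun k => measurable_quadForm (hm _ _)

end OperatorIntegral

/-! ### The quantum coupling induced by a semiclassical coupling -/

instance : SecondCountableTopology (H1 d) :=
  haveI : Fact ((2 : ℝ≥0∞) ≠ ∞) := ⟨by simp⟩
  inferInstance

instance : SecondCountableTopology (H2 d) :=
  haveI : Fact ((2 : ℝ≥0∞) ≠ ∞) := ⟨by simp⟩
  haveI : SFinite (volume : Measure (Pos d × Pos d)) := inferInstance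
  haveI : MeasurableSpace.CountablyGenerated (Pos d × Pos d) := inferInstance
  inferInstance

theorem planck_pos {ħ : ℝ} (hħ : 0 < ħ) : 0 < planck ħ := by
  unfold planck
  positivity

theorem quadForm_eq_setLIntegral {f : Measure (Phase d)}
    {γ : VectorMeasure (Phase d) (H1 d →L[ℂ] H1 d)} {Γ : Phase d → H1 d →L[ℂ] H1 d}
    (hΓ : IsDensity f γ Γ) {A : Set (Phase d)} (hA : MeasurableSet A) (φ : H1 d) :
    quadForm (γ A) φ = ∫⁻ z in A, quadForm (Γ z) φ ∂f := by
  rw [lintegral_quadForm hΓ.nonneg (hΓ.integrable φ φ).integrableOn, hΓ.integral_eq A hA]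
  rfl

/-- The density of a coupling has constant trace `h^{-d}`. -/
theorem ae_opTrace_density {ħ : ℝ} {f : Measure (Phase d)} [IsFiniteMeasure f]
    {ρ : H1 d →L[ℂ] H1 d} {γ : VectorMeasure (Phase d) (H1 d →L[ℂ] H1 d)}
    (hγ : IsCoupling ħ f ρ γ) {Γ : Phase d → H1 d →L[ℂ] H1 d} (hΓ : IsDensity f γ Γ) :
    ∀ᵐ z ∂f, ENNReal.ofReal (planck ħ ^ d) * opTrace (Γ z) = 1 := by
  have hm := measurable_opTrace hΓ.nonneg hΓ.measurable
  refine ae_eq_of_forall_setLIntegral_eq_of_sigmaFinite (hm.const_mul _) measurable_const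
    fun A hA _ => ?_
  rw [lintegral_const_mul _ hm, ← opTrace_eq_lintegral hΓ.nonneg hΓ.measurable (hγ.1 A hA)
    (quadForm_eq_setLIntegral hΓ hA), hγ.2.2 A hA]
  simp

/-- The positive operator `|ψ_z⟩⟨ψ_z| ⊗ A` on the two-particle space. -/
noncomputable def coherentTensor {ħ : ℝ} (hħ : 0 < ħ) (z : Phase d) (A : H1 d →L[ℂ] H1 d) :
    H2 d →L[ℂ] H2 d :=
  tensorL (coherent hħ z) ∘L A ∘L (tensorL (coherent hħ z)).adjoint

theorem coherentTensor_nonneg {ħ : ℝ} (hħ : 0 < ħ) (z : Phase d) {A : H1 d →L[ℂ] H1 d}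
    (hA : 0 ≤ A) : 0 ≤ coherentTensor hħ z A :=
  conj_adjoint_nonneg hA _

theorem opTrace_coherentTensor {ħ : ℝ} (hħ : 0 < ħ) (z : Phase d) {A : H1 d →L[ℂ] H1 d}
    (hA : 0 ≤ A) : opTrace (coherentTensor hħ z A) = opTrace A :=
  opTrace_conj_adjoint hA fun χ => by simp [norm_tensor]

theorem quadForm_coherentTensor_tensor {ħ : ℝ} (hħ : 0 < ħ) (z : Phase d) {A : H1 d →L[ℂ] H1 d}
    (hA : 0 ≤ A) (φ χ : H1 d) :
    quadForm (coherentTensor hħ z A) (tensor φ χ) =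
      ‖⟪φ, coherent hħ z⟫_ℂ‖ₑ ^ 2 * quadForm A χ := by
  rw [coherentTensor, quadForm_conj_adjoint, adjoint_tensorL_tensor, quadForm_smul hA,
    enorm_inner_comm]

theorem measurable_coherentTensor {ħ : ℝ} (hħ : 0 < ħ) {Γ : Phase d → H1 d →L[ℂ] H1 d}
    (hm : ∀ u v, Measurable fun z => ⟪u, Γ z v⟫_ℂ) (u v : H2 d) :
    Measurable fun z => ⟪u, coherentTensor hħ z (Γ z) v⟫_ℂ := by
  have hc (u : H2 d) : Continuous fun z : Phase d => (tensorL (coherent hħ z)).adjoint u :=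
    ((ContinuousLinearMap.adjoint (𝕜 := ℂ) (E := H1 d) (F := H2 d)).continuous.comp
      (tensorL.continuous.comp (continuous_coherent hħ))).clm_apply continuous_const
  simp only [coherentTensor, ContinuousLinearMap.comp_apply,
    ← ContinuousLinearMap.adjoint_inner_left (tensorL _)]
  exact measurable_inner_apply hm (hc u) (hc v)

theorem quadForm_toeplitz {ħ : ℝ} (hħ : 0 < ħ) (f : Measure (Phase d)) [IsFiniteMeasure f]
    (φ : H1 d) : quadForm (toeplitz hħ f) φ =
      ENNReal.ofReal (planck ħ ^ d)⁻¹ * ∫⁻ z, ‖⟪φ, coherent hħ z⟫_ℂ‖ₑ ^ 2 ∂f := by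
  have hc : Continuous fun z : Phase d =>
      InnerProductSpace.rankOne ℂ (coherent hħ z) (coherent hħ z) :=
    ((ContinuousLinearMap.smulRightL ℂ (H1 d) (H1 d)).continuous.comp
      ((innerSL ℂ).continuous.comp (continuous_coherent hħ))).clm_apply (continuous_coherent hħ)
  have hi : Integrable (fun z : Phase d =>
      InnerProductSpace.rankOne ℂ (coherent hħ z) (coherent hħ z)) f :=
    Integrable.of_bound hc.aestronglyMeasurable 1 (ae_of_all _ fun z => by simp)
  let L : (H1 d →L[ℂ] H1 d) →L[ℂ] ℂ :=
    (innerSL ℂ φ) ∘L (ContinuousLinearMap.apply ℂ (H1 d) φ)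
  have hL (z : Phase d) : L (InnerProductSpace.rankOne ℂ (coherent hħ z) (coherent hħ z)) =
      ((‖⟪φ, coherent hħ z⟫_ℂ‖ ^ 2 : ℝ) : ℂ) := by
    change ⟪φ, InnerProductSpace.rankOne ℂ (coherent hħ z) (coherent hħ z) φ⟫_ℂ = _
    rw [InnerProductSpace.rankOne_apply, inner_smul_right, ← inner_conj_symm (coherent hħ z) φ,
      ← Complex.normSq_eq_conj_mul_self, Complex.normSq_eq_norm_sq]
  have h1 : ⟪φ, toeplitz hħ f φ⟫_ℂ =
      (((planck ħ ^ d)⁻¹ * ∫ z, ‖⟪φ, coherent hħ z⟫_ℂ‖ ^ 2 ∂f : ℝ) : ℂ) := by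
    change L (toeplitz hħ f) = _
    rw [toeplitz, map_smul, ← L.integral_comp_comm hi]
    simp_rw [hL]
    rw [integral_complex_ofReal]
    push_cast
    rfl
  have hi2 : Integrable (fun z : Phase d => ‖⟪φ, coherent hħ z⟫_ℂ‖ ^ 2) f := by
    have := (L.integrable_comp hi).norm
    refine this.congr (ae_of_all _ fun z => ?_)
    simp only [hL, Complex.norm_real]
    exact Real.norm_of_nonneg (by positivity)
  rw [quadForm, h1, Complex.ofReal_re, ENNReal.ofReal_mul (by have := planck_pos hħ; positivity),
    ofReal_integral_eq_lintegral_ofReal hi2 (ae_of_all _ fun z => by positivity)]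
  simp_rw [enorm_sq_eq_ofReal]

/-- A semiclassical coupling `γ(dz) = Γ(z) f(dz)` of `f` and `ρ` induces a quantum coupling
`h^{-d} ∫ |ψ_z⟩⟨ψ_z| ⊗ Γ(z) f(dz)` of the Toeplitz operator of `f` and `ρ`. -/
theorem exists_isQuantumCoupling {ħ : ℝ} (hħ : 0 < ħ) {f : Measure (Phase d)}
    [IsProbabilityMeasure f] {ρ : H1 d →L[ℂ] H1 d}
    {γ : VectorMeasure (Phase d) (H1 d →L[ℂ] H1 d)}
    (hγ : IsCoupling ħ f ρ γ) {Γ : Phase d → H1 d →L[ℂ] H1 d} (hΓ : IsDensity f γ Γ) :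
    ∃ T : H2 d →L[ℂ] H2 d, IsQuantumCoupling ħ (toeplitz hħ f) ρ T ∧
      ∀ s, quadForm T s =
        ∫⁻ z, quadForm (coherentTensor hħ z (Γ z)) s ∂(ENNReal.ofReal (planck ħ ^ d)⁻¹ • f) := by
  have hp : 0 < planck ħ ^ d := pow_pos (planck_pos hħ) d
  set c := ENNReal.ofReal (planck ħ ^ d) with hc
  set c' := ENNReal.ofReal (planck ħ ^ d)⁻¹ with hc'
  have hcc : c * c' = 1 := by
    rw [hc, hc', ← ENNReal.ofReal_mul hp.le, mul_inv_cancel₀ hp.ne', ENNReal.ofReal_one]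
  have hc't : c' ≠ ∞ := ENNReal.ofReal_ne_top
  have htr : ∀ᵐ z ∂f, opTrace (Γ z) = c' := by
    filter_upwards [ae_opTrace_density hγ hΓ] with z hz
    calc opTrace (Γ z) = c * c' * opTrace (Γ z) := by rw [hcc, one_mul]
      _ = c' * (c * opTrace (Γ z)) := by ring
      _ = c' := by rw [hz, mul_one]
  have hG (z : Phase d) := coherentTensor_nonneg hħ z (hΓ.nonneg z)
  have hm := measurable_coherentTensor hħ hΓ.measurable
  have : IsFiniteMeasure (c' • f) := Measure.smul_finite f hc't
  have hbd : ∀ᵐ z ∂(c' • f), opTrace (coherentTensor hħ z (Γ z)) ≤ c' := by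
    refine Measure.ae_smul_measure ?_ _
    filter_upwards [htr] with z hz
    rw [opTrace_coherentTensor hħ z (hΓ.nonneg z), hz]
  obtain ⟨T, hT, hTG⟩ := exists_operator_integral hG hm hc't hbd
  obtain ⟨w, hw, ⟨b⟩⟩ := exists_hilbertBasis_countable (H := H1 d)
  refine ⟨T, ⟨⟨hT, ?_⟩, fun φ => ?_, fun φ => ?_⟩, hTG⟩
  · rw [opTrace_eq_lintegral hG hm hT hTG, lintegral_smul_measure]
    simp_rw [opTrace_coherentTensor hħ _ (hΓ.nonneg _)]
    rw [lintegral_congr_ae htr, lintegral_const, measure_univ, mul_one, mul_comm 2 d, pow_mul,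
      ENNReal.ofReal_pow hp.le, ← hc, smul_eq_mul]
    calc c ^ 2 * (c' * c') = (c * c') * (c * c') := by ring
      _ = 1 := by rw [hcc, one_mul]
  · have h := formTrace_compression_eq_lintegral hm hT hTG (tensorL.flip φ) b
    simp only [ContinuousLinearMap.flip_apply, tensorL_apply,
      quadForm_coherentTensor_tensor hħ _ (hΓ.nonneg _), ENNReal.tsum_mul_right,
      tsum_enorm_inner_sq] at h
    rw [partialTrace₁, h, lintegral_smul_measure, smul_eq_mul, ← mul_assoc, hcc, one_mul, ← hγ.2.1,
      quadForm_eq_setLIntegral hΓ MeasurableSet.univ, Measure.restrict_univ]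
    refine lintegral_congr fun z => ?_
    rw [← ofReal_norm, norm_coherent]
    simp
  · have h := formTrace_compression_eq_lintegral hm hT hTG (tensorL φ) b
    simp only [tensorL_apply,
      quadForm_coherentTensor_tensor hħ _ (hΓ.nonneg _), ENNReal.tsum_mul_left,
      ← opTrace_eq_tsum (hΓ.nonneg _) b] at h
    rw [partialTrace₂, h, lintegral_smul_measure, smul_eq_mul, ← mul_assoc, hcc, one_mul,
      quadForm_toeplitz, ← hc', mul_comm, ← lintegral_mul_const' _ _ hc't]
    refine lintegral_congr_ae ?_
    filter_upwards [htr] with z hz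
    rw [hz]

/-! ### The cost of the induced coupling -/

theorem sum_lintegral_le_lintegral_sum {Ω ι : Type*} [MeasurableSpace Ω] (μ : Measure Ω)
    (s : Finset ι) (N : ι → Ω → ℝ≥0∞) :
    ∑ j ∈ s, ∫⁻ ω, N j ω ∂μ ≤ ∫⁻ ω, ∑ j ∈ s, N j ω ∂μ := by
  classical
  induction s using Finset.induction_on with
  | empty => simp
  | insert a s ha ih =>
    simp_rw [Finset.sum_insert ha]
    exact (add_le_add_right ih _).trans (le_lintegral_add _ _)

section Momentum

variable {V : Type*} [NormedAddCommGroup V] [NormedSpace ℝ V] [MeasureSpace V]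

theorem momentumForm_le {ħ : ℝ} {v : V} {ψ g : Lp ℂ 2 (volume : Measure V)}
    (h : IsMomentum ħ v ψ g) (a : ℝ) : momentumForm ħ v a ψ ≤ ‖g - (a : ℂ) • ψ‖ₑ ^ 2 :=
  iInf₂_le g h

theorem exists_isMomentum_of_momentumForm_ne_top {ħ : ℝ} {v : V} {a : ℝ}
    {ψ : Lp ℂ 2 (volume : Measure V)} (h : momentumForm ħ v a ψ ≠ ∞) :
    ∃ g, IsMomentum ħ v ψ g := by
  by_contra hg
  push Not at hg
  exact h (by simp [momentumForm, hg])

variable [BorelSpace V] [IsFiniteMeasureOnCompacts (volume : Measure V)] [FiniteDimensional ℝ V]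

theorem IsMomentum.unique {ħ : ℝ} {v : V} {ψ g g' : Lp ℂ 2 (volume : Measure V)}
    (h : IsMomentum ħ v ψ g) (h' : IsMomentum ħ v ψ g') : g = g' := by
  rw [isMomentum_iff] at h h'
  have := (denseRange_testToL2 (V := V)).equalizer
    (g := fun w => ⟪w, g⟫_ℂ) (h := fun w => ⟪w, g'⟫_ℂ) (by fun_prop) (by fun_prop)
    (funext fun φ => (h φ).trans (h' φ).symm)
  exact ext_inner_left ℂ fun w => congrFun this w

theorem momentumForm_eq {ħ : ℝ} {v : V} {ψ g : Lp ℂ 2 (volume : Measure V)}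
    (h : IsMomentum ħ v ψ g) (a : ℝ) : momentumForm ħ v a ψ = ‖g - (a : ℂ) • ψ‖ₑ ^ 2 :=
  le_antisymm (momentumForm_le h a)
    (le_iInf₂ fun g' h' => le_of_eq (by rw [h.unique h']))

end Momentum

/-- The form of the relative momentum on `ψ_z ⊗ χ`: the position fluctuation `(y_j - x_j) ψ_z` of
the coherent state is orthogonal to `ψ_z` and adds `ħ / 2`. -/
theorem exists_isMomentum_coherent_tensor {ħ : ℝ} (hħ : 0 < ħ) (z : Phase d) (j : Fin d)
    {χ : H1 d}
    (h : momentumForm ħ (EuclideanSpace.single j (1 : ℝ)) (z.2 j) χ ≠ ∞) :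
    ∃ Φ, IsMomentum ħ
        ((EuclideanSpace.single j (1 : ℝ), -EuclideanSpace.single j (1 : ℝ)) : Pos d × Pos d)
        (tensor (coherent hħ z) χ) Φ ∧
      ‖Φ‖ₑ ^ 2 = ENNReal.ofReal (ħ / 2) * ‖χ‖ₑ ^ 2 +
        momentumForm ħ (EuclideanSpace.single j (1 : ℝ)) (z.2 j) χ := by
  obtain ⟨g, hg⟩ := exists_isMomentum_of_momentumForm_ne_top h
  refine ⟨_, (isMomentum_coherent hħ z j).tensor hg, ?_⟩
  have e : tensor ((z.2 j : ℂ) • coherent hħ z + Complex.I • coherentCoord hħ z j) χ -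
      tensor (coherent hħ z) g = Complex.I • tensor (coherentCoord hħ z j) χ -
        tensor (coherent hħ z) (g - (z.2 j : ℂ) • χ) := by
    simp only [← tensorL_apply, map_add, map_smul, map_sub, add_apply,
      smul_apply]
    abel
  have h0 : ⟪Complex.I • tensor (coherentCoord hħ z j) χ,
      tensor (coherent hħ z) (g - (z.2 j : ℂ) • χ)⟫_ℂ = 0 := by
    rw [inner_smul_left, inner_tensor, inner_coherentCoord_coherent]
    simp
  have h1 : ‖Complex.I • tensor (coherentCoord hħ z j) χ -
      tensor (coherent hħ z) (g - (z.2 j : ℂ) • χ)‖ ^ 2 =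
        ħ / 2 * ‖χ‖ ^ 2 + ‖g - (z.2 j : ℂ) • χ‖ ^ 2 := by
    rw [@norm_sub_sq ℂ, h0, norm_smul, norm_tensor, norm_tensor, norm_coherent, mul_pow, mul_pow,
      norm_coherentCoord_sq]
    simp
  rw [e, momentumForm_eq hg, enorm_sq_eq_ofReal, h1, ENNReal.ofReal_add (by positivity)
    (by positivity), ENNReal.ofReal_mul (by positivity), enorm_sq_eq_ofReal, enorm_sq_eq_ofReal]

section Position

variable {V : Type*} [MeasureSpace V]

theorem enorm_sq_eq_lintegral (u : Lp ℂ 2 (volume : Measure V)) :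
    ‖u‖ₑ ^ 2 = ∫⁻ x, ‖u x‖ₑ ^ 2 := by
  have h := eLpNorm_nnreal_pow_eq_lintegral (f := (u : V → ℂ)) (μ := volume) (p := 2) two_ne_zero
  rw [Lp.enorm_def]
  simpa using h

theorem memLp_bounded_mul {m : V → ℝ} (hm : AEStronglyMeasurable m volume) {C : ℝ}
    (hC : ∀ x, ‖m x‖ ≤ C) (u : Lp ℂ 2 (volume : Measure V)) :
    MemLp (fun x => (m x : ℂ) * u x) 2 volume := by
  refine (Lp.memLp u).of_le_mul (c := C)
    ((Complex.continuous_ofReal.comp_aestronglyMeasurable hm).mul (Lp.aestronglyMeasurable u))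
    (ae_of_all _ fun x => ?_)
  rw [norm_mul, Complex.norm_real]
  gcongr
  exact hC x

/-- Multiplication by a bounded real function on `L²`. -/
noncomputable def boundedMul {m : V → ℝ} (hm : AEStronglyMeasurable m volume) {C : ℝ}
    (hC : ∀ x, ‖m x‖ ≤ C) :
    Lp ℂ 2 (volume : Measure V) →ₗ[ℂ] Lp ℂ 2 (volume : Measure V) where
  toFun u := (memLp_bounded_mul hm hC u).toLp _
  map_add' u u' := by
    rw [← MemLp.toLp_add]
    refine MemLp.toLp_congr _ _ ?_
    filter_upwards [Lp.coeFn_add u u'] with x h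
    rw [h, Pi.add_apply, mul_add]
    rfl
  map_smul' c u := by
    simp only [RingHom.id_apply]
    rw [← MemLp.toLp_const_smul]
    refine MemLp.toLp_congr _ _ ?_
    filter_upwards [Lp.coeFn_smul c u] with x h
    simp only [h, Pi.smul_apply, smul_eq_mul]
    ring

variable {m : V → ℝ} (hm : AEStronglyMeasurable m volume) {C : ℝ} (hC : ∀ x, ‖m x‖ ≤ C)

theorem coeFn_boundedMul (u : Lp ℂ 2 (volume : Measure V)) :
    (boundedMul hm hC u : V → ℂ) =ᵐ[volume] fun x => (m x : ℂ) * u x :=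
  (memLp_bounded_mul hm hC u).coeFn_toLp

theorem inner_boundedMul_left (u v : Lp ℂ 2 (volume : Measure V)) :
    ⟪boundedMul hm hC u, v⟫_ℂ = ⟪u, boundedMul hm hC v⟫_ℂ := by
  simp only [L2.inner_def]
  refine integral_congr_ae ?_
  filter_upwards [coeFn_boundedMul hm hC u, coeFn_boundedMul hm hC v] with x h1 h2
  rw [h1, h2]
  simp only [RCLike.inner_apply, map_mul, Complex.conj_ofReal]
  ring

theorem enorm_boundedMul_sq (u : Lp ℂ 2 (volume : Measure V)) :
    ‖boundedMul hm hC u‖ₑ ^ 2 = ∫⁻ x, ‖m x‖ₑ ^ 2 * ‖u x‖ₑ ^ 2 := by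
  rw [enorm_sq_eq_lintegral]
  refine lintegral_congr_ae ?_
  filter_upwards [coeFn_boundedMul hm hC u] with x h
  rw [h, enorm_mul, mul_pow, ← ofReal_norm (m x : ℂ), Complex.norm_real, ofReal_norm]

end Position

/-- The position variance of a coherent state is `dħ / 2`. -/
theorem lintegral_sq_mul_coherentFun {ħ : ℝ} (hħ : 0 < ħ) (z : Phase d) (u : Pos d) :
    ∫⁻ y, ‖y - u‖ₑ ^ 2 * ‖coherentFun ħ z y‖ₑ ^ 2 =
      ‖z.1 - u‖ₑ ^ 2 + ENNReal.ofReal (d * (ħ / 2)) := by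
  have hb := inv_pos.2 hħ
  set k := (Real.pi * ħ) ^ (-(d : ℝ) / 2) with hk
  have h1 : k * ∫ y, Real.exp (-ħ⁻¹ * ‖y - z.1‖ ^ 2) = 1 := by
    have := integral_norm_coherentFun_sq hħ z
    simp_rw [norm_coherentFun_sq hħ] at this
    rwa [integral_const_mul] at this
  -- `(y_j - u_j)² = (y_j - x_j)² + 2 (x_j - u_j) (y_j - x_j) + (x_j - u_j)²`
  let F (j : Fin d) (y : Pos d) : ℝ :=
    k * ((y j - z.1 j) ^ 2 * Real.exp (-ħ⁻¹ * ‖y - z.1‖ ^ 2)) +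
      2 * (z.1 j - u j) * k * ((y j - z.1 j) * Real.exp (-ħ⁻¹ * ‖y - z.1‖ ^ 2)) +
      (z.1 j - u j) ^ 2 * k * Real.exp (-ħ⁻¹ * ‖y - z.1‖ ^ 2)
  have i1 (j : Fin d) := (integrable_coord_sq_mul_gaussian hb z.1 j).const_mul k
  have i2 (j : Fin d) := (integrable_coord_mul_gaussian hb z.1 j).const_mul
    (2 * (z.1 j - u j) * k)
  have i3 (j : Fin d) := (integrable_gaussian hb z.1).const_mul ((z.1 j - u j) ^ 2 * k)
  have hFi (j : Fin d) : Integrable (F j) := ((i1 j).add (i2 j)).add (i3 j)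
  have hF (j : Fin d) : ∫ y, F j y = ħ / 2 + (z.1 j - u j) ^ 2 := by
    have e : ∫ y, F j y = _ := integral_add ((i1 j).add (i2 j)) (i3 j)
    have e' := integral_add (i1 j) (i2 j)
    rw [e, e']
    simp only [integral_const_mul]
    rw [integral_coord_mul_gaussian, integral_coord_sq_mul_gaussian hb, mul_left_comm k, h1,
      mul_assoc _ k, mul_assoc _ k, h1]
    field_simp
    ring
  have hsum (y : Pos d) : ‖y - u‖ ^ 2 * ‖coherentFun ħ z y‖ ^ 2 = ∑ j, F j y := by
    rw [norm_coherentFun_sq hħ, ← hk, EuclideanSpace.real_norm_sq_eq, Finset.sum_mul]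
    refine Finset.sum_congr rfl fun j _ => ?_
    simp only [F, PiLp.sub_apply]
    ring
  simp_rw [enorm_sq_eq_ofReal, ← ENNReal.ofReal_mul (sq_nonneg _), hsum]
  rw [← ofReal_integral_eq_lintegral_ofReal (integrable_finsetSum _ fun j _ => hFi j)
    (ae_of_all _ fun y => (by positivity : 0 ≤ ‖y - u‖ ^ 2 * ‖coherentFun ħ z y‖ ^ 2).trans_eq
      (hsum y)),
    integral_finsetSum _ fun j _ => hFi j, ← ENNReal.ofReal_add (by positivity) (by positivity)]
  simp_rw [hF]
  rw [EuclideanSpace.real_norm_sq_eq, Finset.sum_add_distrib]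
  simp [add_comm]

theorem lintegral_position_coherent_tensor {ħ : ℝ} (hħ : 0 < ħ) (z : Phase d) (χ : H1 d) :
    ∫⁻ x : Pos d × Pos d, ‖x.1 - x.2‖ₑ ^ 2 * ‖tensor (coherent hħ z) χ x‖ₑ ^ 2 =
      (∫⁻ y, ‖z.1 - y‖ₑ ^ 2 * ‖χ y‖ₑ ^ 2) + ENNReal.ofReal (d * (ħ / 2)) * ‖χ‖ₑ ^ 2 := by
  have hcm : Measurable (coherentFun ħ z) := by
    have hc : Continuous (coherentFun ħ z) := by unfold coherentFun; fun_prop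
    exact hc.measurable
  have hχ : AEMeasurable (fun y => ‖χ y‖ₑ ^ 2) (volume : Measure (Pos d)) :=
    (Lp.aestronglyMeasurable χ).enorm.pow_const 2
  have h1 : ∫⁻ x : Pos d × Pos d, ‖x.1 - x.2‖ₑ ^ 2 * ‖tensor (coherent hħ z) χ x‖ₑ ^ 2 =
      ∫⁻ x : Pos d × Pos d, ‖x.1 - x.2‖ₑ ^ 2 * ‖coherentFun ħ z x.1‖ₑ ^ 2 * ‖χ x.2‖ₑ ^ 2 := by
    refine lintegral_congr_ae ?_
    filter_upwards [coeFn_tensor (coherent hħ z) χ, ae_eq_comp_fst (coeFn_coherent hħ z)]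
      with x h1 h2
    rw [h1, h2, enorm_mul, mul_pow, mul_assoc]
  have hmeas : AEMeasurable (fun x : Pos d × Pos d =>
      ‖x.1 - x.2‖ₑ ^ 2 * ‖coherentFun ħ z x.1‖ₑ ^ 2 * ‖χ x.2‖ₑ ^ 2)
      ((volume : Measure (Pos d)).prod (volume : Measure (Pos d))) :=
    (((measurable_fst.sub measurable_snd).enorm.pow_const 2).mul
      ((hcm.comp measurable_fst).enorm.pow_const 2)).aemeasurable.mul hχ.comp_snd
  rw [h1, Measure.volume_eq_prod, lintegral_prod_symm _ hmeas]
  have h2 (y : Pos d) : ∫⁻ x, ‖x - y‖ₑ ^ 2 * ‖coherentFun ħ z x‖ₑ ^ 2 * ‖χ y‖ₑ ^ 2 =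
      ‖z.1 - y‖ₑ ^ 2 * ‖χ y‖ₑ ^ 2 + ENNReal.ofReal (d * (ħ / 2)) * ‖χ y‖ₑ ^ 2 := by
    rw [lintegral_mul_const' _ _ (by finiteness), lintegral_sq_mul_coherentFun hħ, add_mul]
  simp only [h2]
  rw [lintegral_add_right' _ (hχ.const_mul _), lintegral_const_mul' _ _ ENNReal.ofReal_ne_top,
    ← enorm_sq_eq_lintegral]

section Cost

variable {ħ : ℝ} (hħ : 0 < ħ) {μ : Measure (Phase d)} {Γ : Phase d → H1 d →L[ℂ] H1 d}
  {T : H2 d →L[ℂ] H2 d} {ι : Type*} (b : HilbertBasis ι ℂ (H1 d))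

/-- The component `p₁ - p₂` in direction `j` of the cost: `exists_dual_sum_le` with smooth compactly
supported test functions. -/
theorem sum_momentumForm_le (hΓ : ∀ z, 0 ≤ Γ z)
    (hm : ∀ u v, Measurable fun z => ⟪u, Γ z v⟫_ℂ) (hT : 0 ≤ T)
    (hTG : ∀ s, quadForm T s = ∫⁻ z, quadForm (coherentTensor hħ z (Γ z)) s ∂μ)
    {n : ℕ} {e : Fin n → H2 d} (he : Orthonormal ℂ e) (j : Fin d) :
    ∑ i, momentumForm ħ
        ((EuclideanSpace.single j (1 : ℝ), -EuclideanSpace.single j (1 : ℝ)) : Pos d × Pos d) 0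
        (opSqrt T (e i)) ≤
      ∫⁻ z, ∑' l, (ENNReal.ofReal (ħ / 2) * ‖opSqrt (Γ z) (b l)‖ₑ ^ 2 +
        momentumForm ħ (EuclideanSpace.single j (1 : ℝ)) (z.2 j) (opSqrt (Γ z) (b l))) ∂μ := by
  by_cases hfin : ∫⁻ z, ∑' l, (ENNReal.ofReal (ħ / 2) * ‖opSqrt (Γ z) (b l)‖ₑ ^ 2 +
      momentumForm ħ (EuclideanSpace.single j (1 : ℝ)) (z.2 j) (opSqrt (Γ z) (b l))) ∂μ = ∞
  · rw [hfin]
    exact le_top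
  obtain ⟨g, hg, hgN⟩ := exists_dual_sum_le (J := testToL2) (T := testMomentum ħ
    ((EuclideanSpace.single j (1 : ℝ), -EuclideanSpace.single j (1 : ℝ)) : Pos d × Pos d))
    denseRange_testToL2 hT (fun s => measurable_quadForm (measurable_coherentTensor hħ hm s s))
    hTG (ι := ι) (fun z hz => by
      have hz' (l : ι) : momentumForm ħ (EuclideanSpace.single j (1 : ℝ)) (z.2 j)
          (opSqrt (Γ z) (b l)) ≠ ∞ := fun h =>
        ENNReal.ne_top_of_tsum_ne_top hz l (by rw [h, add_top])
      choose Φ hΦ hΦ' using fun l => exists_isMomentum_coherent_tensor hħ z j (hz' l)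
      refine ⟨Φ, fun φ => ?_, le_of_eq (tsum_congr hΦ')⟩
      rw [coherentTensor, quadForm_conj_adjoint_eq_tsum (hΓ z) _ b]
      refine tsum_congr fun l => ?_
      rw [tensorL_apply, enorm_inner_comm, ← (isMomentum_iff _ _ _ _).1 (hΦ l),
        enorm_inner_comm]) hfin he
  refine le_trans (Finset.sum_le_sum fun i _ => ?_) hgN
  simpa using momentumForm_le ((isMomentum_iff _ _ _ _).2 (hg i)) 0

/-- The part `|x₁ - x₂|²` of the cost: `exists_dual_sum_le` for truncated multipliers, with all of
`L²` as test space, and monotone convergence. -/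
theorem sum_position_le (hΓ : ∀ z, 0 ≤ Γ z)
    (hm : ∀ u v, Measurable fun z => ⟪u, Γ z v⟫_ℂ) (hT : 0 ≤ T)
    (hTG : ∀ s, quadForm T s = ∫⁻ z, quadForm (coherentTensor hħ z (Γ z)) s ∂μ)
    {n : ℕ} {e : Fin n → H2 d} (he : Orthonormal ℂ e) :
    ∑ i, ∫⁻ x : Pos d × Pos d, ‖x.1 - x.2‖ₑ ^ 2 * ‖opSqrt T (e i) x‖ₑ ^ 2 ≤
      ∫⁻ z, ∑' l, ((∫⁻ y, ‖z.1 - y‖ₑ ^ 2 * ‖opSqrt (Γ z) (b l) y‖ₑ ^ 2) +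
        ENNReal.ofReal (d * (ħ / 2)) * ‖opSqrt (Γ z) (b l)‖ₑ ^ 2) ∂μ := by
  simp_rw [← lintegral_position_coherent_tensor hħ]
  set M := ∫⁻ z, ∑' l, (∫⁻ x : Pos d × Pos d, ‖x.1 - x.2‖ₑ ^ 2 *
    ‖tensor (coherent hħ z) (opSqrt (Γ z) (b l)) x‖ₑ ^ 2) ∂μ with hM
  by_cases hfin : M = ∞
  · rw [hfin]
    exact le_top
  -- truncate the unbounded multiplier at height `k`
  let m (k : ℕ) (x : Pos d × Pos d) : ℝ := min ‖x.1 - x.2‖ k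
  have hmm (k : ℕ) : AEStronglyMeasurable (m k) volume :=
    Continuous.aestronglyMeasurable (by fun_prop)
  have hm0 (k : ℕ) (x : Pos d × Pos d) : 0 ≤ m k x := by positivity
  have hmC (k : ℕ) (x : Pos d × Pos d) : ‖m k x‖ ≤ k := by
    rw [Real.norm_of_nonneg (hm0 k x)]
    exact min_le_right _ _
  have hmle (k : ℕ) (x : Pos d × Pos d) : ‖m k x‖ₑ ≤ ‖x.1 - x.2‖ₑ := by
    rw [← ofReal_norm, ← ofReal_norm, Real.norm_of_nonneg (hm0 k x)]
    exact ENNReal.ofReal_le_ofReal (min_le_left _ _)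
  have hk (k : ℕ) : ∑ i, ∫⁻ x : Pos d × Pos d, ‖m k x‖ₑ ^ 2 * ‖opSqrt T (e i) x‖ₑ ^ 2 ≤ M := by
    obtain ⟨g, hg, hgN⟩ := exists_dual_sum_le (J := LinearMap.id)
      (T := boundedMul (hmm k) (hmC k)) (Function.surjective_id.denseRange) hT
      (fun s => measurable_quadForm (measurable_coherentTensor hħ hm s s))
      hTG (ι := ι) (fun z _ => ⟨fun l => boundedMul (hmm k) (hmC k)
        (tensor (coherent hħ z) (opSqrt (Γ z) (b l))), fun φ => by
          rw [coherentTensor, quadForm_conj_adjoint_eq_tsum (hΓ z) _ b]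
          refine tsum_congr fun l => ?_
          rw [tensorL_apply, inner_boundedMul_left]
          rfl, ENNReal.tsum_le_tsum fun l => by
          rw [enorm_boundedMul_sq]
          refine lintegral_mono fun x => ?_
          gcongr
          exact hmle k x⟩) hfin he
    have hgi (i) : g i = boundedMul (hmm k) (hmC k) (opSqrt T (e i)) :=
      ext_inner_left ℂ fun v => by
        rw [← inner_boundedMul_left]
        exact hg i v
    simpa only [hgi, enorm_boundedMul_sq] using hgN
  refine le_of_tendsto' (x := Filter.atTop) (tendsto_finsetSum _ fun i _ => ?_) hk
  refine lintegral_tendsto_of_tendsto_of_monotone (fun k => ?_) (ae_of_all _ fun x => ?_)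
    (ae_of_all _ fun x => ?_)
  · exact ((hmm k).enorm.pow_const 2).mul ((Lp.aestronglyMeasurable _).enorm.pow_const 2)
  · intro k k' hkk
    have : ‖m k x‖ₑ ≤ ‖m k' x‖ₑ := by
      rw [← ofReal_norm, ← ofReal_norm, Real.norm_of_nonneg (hm0 k x),
        Real.norm_of_nonneg (hm0 k' x)]
      exact ENNReal.ofReal_le_ofReal (min_le_min_left _ (by exact_mod_cast hkk))
    simp only
    gcongr
  · refine tendsto_const_nhds.congr' ?_
    obtain ⟨k₀, hk₀⟩ := exists_nat_ge ‖x.1 - x.2‖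
    filter_upwards [Filter.eventually_ge_atTop k₀] with k hkk
    have : m k x = ‖x.1 - x.2‖ :=
      min_eq_left (hk₀.trans (by exact_mod_cast hkk))
    rw [this, enorm_norm]

/-- The cost of the weak integral of `|ψ_z⟩⟨ψ_z| ⊗ Γ(z)`: the coherent states contribute `dħ / 2`
in position and `ħ / 2` for each momentum component. -/
theorem sandwichTrace_costForm₂_le (hΓ : ∀ z, 0 ≤ Γ z)
    (hm : ∀ u v, Measurable fun z => ⟪u, Γ z v⟫_ℂ) (hT : 0 ≤ T)
    (hTG : ∀ s, quadForm T s = ∫⁻ z, quadForm (coherentTensor hħ z (Γ z)) s ∂μ) :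
    sandwichTrace (costForm₂ ħ) T ≤
      ∫⁻ z, (sandwichTrace (costForm ħ z) (Γ z) +
        ENNReal.ofReal (d * ħ) * opTrace (Γ z)) ∂μ := by
  obtain ⟨_, b, -⟩ := exists_hilbertBasis ℂ (H1 d)
  rw [sandwichTrace_eq]
  refine formTrace_le fun n e he => ?_
  simp only [costForm₂, Finset.sum_add_distrib]
  rw [Finset.sum_comm]
  refine (add_le_add (sum_position_le hħ b hΓ hm hT hTG he) (Finset.sum_le_sum fun j _ =>
    sum_momentumForm_le hħ b hΓ hm hT hTG he j)).trans ?_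
  refine (add_le_add_right (sum_lintegral_le_lintegral_sum _ _ _) _).trans
    ((le_lintegral_add _ _).trans (lintegral_mono fun z => ?_))
  rw [← Summable.tsum_finsetSum fun _ _ => ENNReal.summable, ← ENNReal.tsum_add]
  refine le_trans (le_of_eq ?_) (add_le_add_left
    ((tsum_le_formTrace (fun s => costForm ħ z (opSqrt (Γ z) s)) b.orthonormal).trans_eq
      (sandwichTrace_eq _ _).symm) _)
  rw [opTrace_eq_tsum (hΓ z) b, ← ENNReal.tsum_mul_left, ← ENNReal.tsum_add]
  refine tsum_congr fun l => ?_
  rw [quadForm_eq_enorm_opSqrt (hΓ z), costForm, Finset.sum_add_distrib, Finset.sum_const,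
    Finset.card_univ, Fintype.card_fin, nsmul_eq_mul, ← mul_assoc]
  have h1 : ENNReal.ofReal (d * (ħ / 2)) = d * ENNReal.ofReal (ħ / 2) := by
    rw [ENNReal.ofReal_mul (by positivity), ENNReal.ofReal_natCast]
  have h2 : ENNReal.ofReal (d * ħ) = d * ENNReal.ofReal (ħ / 2) + d * ENNReal.ofReal (ħ / 2) := by
    rw [← h1, ← ENNReal.ofReal_add (by positivity) (by positivity)]
    congr 1
    ring
  rw [h1, h2]
  ring

end Cost

end QOT

theorem mainTheorem5 (d : ℕ) (ħ : ℝ) (hħ : 0 < ħ)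
    (f : MeasureTheory.Measure (QOT.Phase d)) [MeasureTheory.IsProbabilityMeasure f]
    (hf2 : ∫⁻ z, (‖z.1‖ₑ ^ 2 + ‖z.2‖ₑ ^ 2) ∂f < ⊤)
    (ρ : QOT.H1 d →L[ℂ] QOT.H1 d) (hρ : QOT.HasTwoMoments ħ ρ) :
    QOT.MKh ħ (QOT.toeplitz hħ f) ρ ^ 2 ≤ QOT.Wh ħ f ρ ^ 2 + ENNReal.ofReal (d * ħ) := by
  have hsq (x : ENNReal) : (x ^ (1 / 2 : ℝ)) ^ 2 = x := by
    rw [← ENNReal.rpow_natCast, ← ENNReal.rpow_mul]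
    norm_num
  rw [QOT.MKh, QOT.Wh, hsq, hsq]
  simp only [QOT.couplingCost, ENNReal.iInf_add]
  refine le_iInf fun γ => le_iInf fun hγ => le_iInf fun Γ => le_iInf fun hΓ => ?_
  obtain ⟨T, hT, hTG⟩ := QOT.exists_isQuantumCoupling hħ hγ hΓ
  refine (iInf₂_le T hT).trans ?_
  have hcost := QOT.sandwichTrace_costForm₂_le hħ hΓ.nonneg hΓ.measurable hT.1.1 hTG
  have hp : 0 < QOT.planck ħ ^ d := pow_pos (QOT.planck_pos hħ) d
  have hcc : ENNReal.ofReal (QOT.planck ħ ^ d) * ENNReal.ofReal (QOT.planck ħ ^ d)⁻¹ = 1 := by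
    rw [← ENNReal.ofReal_mul hp.le, mul_inv_cancel₀ hp.ne', ENNReal.ofReal_one]
  have hmeas := QOT.measurable_opTrace hΓ.nonneg hΓ.measurable
  have htr : ENNReal.ofReal (QOT.planck ħ ^ d) * ∫⁻ z, QOT.opTrace (Γ z) ∂f = 1 := by
    rw [← MeasureTheory.lintegral_const_mul _ hmeas,
      MeasureTheory.lintegral_congr_ae (QOT.ae_opTrace_density hγ hΓ)]
    simp
  rw [MeasureTheory.lintegral_smul_measure, smul_eq_mul,
    MeasureTheory.lintegral_add_right _ (hmeas.const_mul _),
    MeasureTheory.lintegral_const_mul _ hmeas] at hcost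
  rw [mul_comm 2 d, pow_mul, ENNReal.ofReal_pow hp.le]
  generalize ENNReal.ofReal (QOT.planck ħ ^ d) = c at *
  generalize ENNReal.ofReal (QOT.planck ħ ^ d)⁻¹ = c' at *
  generalize ∫⁻ z, QOT.sandwichTrace (QOT.costForm ħ z) (Γ z) ∂f = S at *
  generalize ∫⁻ z, QOT.opTrace (Γ z) ∂f = R at *
  calc c ^ 2 * QOT.sandwichTrace (QOT.costForm₂ ħ) T
      ≤ c ^ 2 * (c' * (S + ENNReal.ofReal (d * ħ) * R)) := by gcongr
    _ = c * c' * (c * S + ENNReal.ofReal (d * ħ) * (c * R)) := by ring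
    _ = c * S + ENNReal.ofReal (d * ħ) := by rw [hcc, htr, one_mul, mul_one]
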